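/- Let $E$ be a countable Hausdorff topological space and let $\hat{\mathcal L}=(\hat{\mathcal L}_{x,y})_{x,y\in E}$ be a stable and conservative $Q$-matrix: $0\le\hat{\mathcal L}_{x,y}<\infty$ for $x\ne y$ and $\sum_{y\neq x}\hat{\mathcal L}_{x,y}=-\hat{\mathcal L}_{x,x}=:\hat{\mathcal L}_x<\infty$. A \emph{minimal process} with generator $\hat{\mathcal L}$ is given by a jump chain $(Y_k)_{k\ge0}$, a Markov chain on $E$ with transition probabilities $\hat{\mathcal L}_{x,y}/\hat{\mathcal L}_x$ ($y\ne x$; the state $x$ is absorbing if $\hat{\mathcal L}_x=0$), and holding times $S_k$ that, given the chain, are independent and exponential with parameters $\hat{\mathcal L}_{Y_k}$ (infinite if the parameter is $0$). It equals $Y_k$ on $[S_0+\dots+S_{k-1},\,S_0+\dots+S_k)$, its explosion time is $\tau=\sum_k S_k$, and it is at an isolated cemetery point $\Delta\notin E$ from $\tau$ onwards. The generator is \emph{stratified}, with stratification $(E_1,\dots,E_N)$, if $E_1,\dots,E_N$ are mutually disjoint subsets of $E$ such that for all $i$ and all $x\in E_i$ the minimal process $Y^x$ started at $x$, with explosion time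 $\tau$, satisfies: (a) for every $t\ge0$, almost surely on $\{t<\tau\}$, $Y^x_t\in E_1\cup\dots\cup E_i$; (b) almost surely on $\{\tau<\infty\}$ there are $j\le i$ and $\varepsilon>0$ with $Y^x_t\in E_j$ for all $t\in(\tau-\varepsilon,\tau)$, and $Y^x_\tau:=\lim_{t\uparrow\tau}Y^x_t$ exists and lies in $E_{j+1}\cup\dots\cup E_N$. Let $\nu$ be a probability measure on $E$ with $\nu(E_1\cup\dots\cup E_N)=1$. A \emph{stratified jump process} $Z$ associated to $(\nu,\hat{\mathcal L})$, with explosion times $0=T_0\le T_1\le\cdots$, is constructed as follows: $Z_0$ has law $\nu$; if $T_i<\infty$, let $Y^{(i)}$ be a minimal process with generator $\hat{\mathcal L}$ started at $Z_{T_i}$, independent of $Z_{[0,T_i]}$ given $Z_{T_i}$, with explosion time $T'_{i+1}$, and set $Z_{T_i+t}=Y^{(i)}_t$ for $t<T'_{i+1}$, $T_{i+1}=T_i+T'_{i+1}$, and $Z_{T_{i+1}}=Y^{(i)}_{T'_{i+1}}$ (the left limit of $Y^{(i)}$ at its explosion time) if $T_{i+1}<\infty$; if $T_i=\infty$, set $T_{i+1}=\infty$.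 For $t$ greater than or equal to the double explosion time $T:=\lim_i T_i$, $Z_t=\Delta$. As usual, the almost sure properties that holding times are positive and that a jump changes the state are taken to hold at every sample point. Let $\mathcal F^Z_t=\sigma(Z_s:s\le t)$. Functions on $E$ are extended by $0$ at $\Delta$, and $\hat{\mathcal L}f(x)=\sum_{y\in E}\hat{\mathcal L}_{x,y}f(y)$. Let $f:E\to\mathbb R$ be bounded and continuous and such that $\hat{\mathcal L}f$ is bounded, and let $$M^f_t=f(Z_t)-f(Z_0)-\int_0^t\hat{\mathcal L}f(Z_s)\,\mathrm ds,\qquad t\ge0.$$ Then for every $n\in\mathbb N$ the process $(M^f_{t\wedge T_n})_{t\ge0}$ is a martingale with respect to the filtration $(\mathcal F^Z_t)_{t\ge0}$. If moreover $T=\infty$ almost surely, then $(M^f_t)_{t\ge0}$ is a martingale with respect to $(\mathcal F^Z_t)_{t\ge0}$. -/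

import Mathlib

open MeasureTheory ProbabilityTheory Filter Topology Set
open scoped NNReal ENNReal

noncomputable section

namespace StratifiedJump

/-- Stable and conservative `Q`-matrices (generators) on a set `E`. -/
structure IsQMatrix {E : Type*} (L : E → E → ℝ) : Prop where
  nonneg : ∀ x y, x ≠ y → 0 ≤ L x y
  conservative : ∀ x, HasSum (fun y : {y : E // y ≠ x} => L x y) (-(L x x))

/-- The rate at which the state `x` is left. -/
def exitRate {E : Type*} (L : E → E → ℝ) (x : E) : ℝ := -(L x x)

open Classical in
/-- Transition matrix of the jump chain. A state of rate zero is absorbing. -/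
def jumpProb {E : Type*} (L : E → E → ℝ) (x y : E) : ℝ :=
  if exitRate L x = 0 then (if x = y then 1 else 0)
  else (if x = y then 0 else L x y / exitRate L x)

/-- The action of the matrix `L` on a function. -/
def genApply {E : Type*} (L : E → E → ℝ) (f : E → ℝ) (x : E) : ℝ := ∑' y, L x y * f y

/-- The `k`-th jumping time of a path with holding times `S 0, S 1, …`. -/
def jumpTime (S : ℕ → ℝ≥0∞) (k : ℕ) : ℝ≥0∞ := ∑ j ∈ Finset.range k, S j

/-- The explosion time of a path with holding times `S 0, S 1, …`. -/
def explosion (S : ℕ → ℝ≥0∞) : ℝ≥0∞ := ⨆ k, jumpTime S k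

open Classical in
/-- The path with successive states `Y k` and holding times `S k`. The value `none` is the
cemetery point; it is taken from the explosion time onwards. -/
def minimalPath {E : Type*} (Y : ℕ → E) (S : ℕ → ℝ≥0∞) (t : ℝ≥0) : Option E :=
  if h : ∃ k, jumpTime S k ≤ t ∧ (t : ℝ≥0∞) < jumpTime S (k + 1) then some (Y h.choose) else none

/-- `(Y, S)` is the sequence of states and the sequence of holding times of a minimal process with
generator `L` and initial distribution `ν`: the sequence `Y` is a Markov chain with initial
distribution `ν` and transition matrix `jumpProb L`, and, given `Y 0, …, Y n`, the variables
`S 0, …, S (n - 1)` are independent and exponential with parameters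
`exitRate L (Y 0), …, exitRate L (Y (n - 1))`. An exponential variable of parameter zero is
infinite. -/
structure IsMinimalProcess {E Ω : Type*} [MeasurableSpace E] [MeasurableSpace Ω]
    (L : E → E → ℝ) (ν : Measure E) (μ : Measure Ω)
    (Y : ℕ → Ω → E) (S : ℕ → Ω → ℝ≥0∞) : Prop where
  measurable_state : ∀ k, Measurable (Y k)
  measurable_holding : ∀ k, Measurable (S k)
  law : ∀ (n : ℕ) (x : ℕ → E) (s : ℕ → ℝ≥0),
    μ {ω | (∀ k ≤ n, Y k ω = x k) ∧ ∀ k < n, (s k : ℝ≥0∞) < S k ω} =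
      ν {x 0} * ENNReal.ofReal (∏ k ∈ Finset.range n,
        (jumpProb L (x k) (x (k + 1)) * Real.exp (-(exitRate L (x k) * s k))))

/-- The path `X` in `E` with cemetery point `none` (an isolated point) converges to the point `y`
of `E` as the time increases to `τ`. -/
def HasLeftLimit {E : Type*} [TopologicalSpace E] (X : ℝ≥0 → Option E) (τ : ℝ≥0) (y : E) : Prop :=
  Tendsto X (𝓝[<] τ) (Filter.map some (𝓝 y))

/-- The tuple `C` of subsets of `E` is a stratification of the generator `L`. Laws of minimal
processes are taken on the space of all sequences of states and holding times. -/
structure IsStratification {E : Type*} [TopologicalSpace E] [MeasurableSpace E]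
    (L : E → E → ℝ) {N : ℕ} (C : Fin N → Set E) : Prop where
  disjoint : Pairwise fun i j => Disjoint (C i) (C j)
  lower : ∀ (i : Fin N), ∀ x ∈ C i, ∀ P : Measure (ℕ → E × ℝ≥0∞),
    IsMinimalProcess L (Measure.dirac x) P (fun k w => (w k).1) (fun k w => (w k).2) →
    ∀ t : ℝ≥0, ∀ᵐ w ∂P, (t : ℝ≥0∞) < explosion (fun k => (w k).2) →
      ∃ j ≤ i, ∃ y ∈ C j, minimalPath (fun k => (w k).1) (fun k => (w k).2) t = some y
  limit : ∀ (i : Fin N), ∀ x ∈ C i, ∀ P : Measure (ℕ → E × ℝ≥0∞),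
    IsMinimalProcess L (Measure.dirac x) P (fun k w => (w k).1) (fun k w => (w k).2) →
    ∀ᵐ w ∂P, explosion (fun k => (w k).2) < ⊤ →
      ∃ j ≤ i,
        (∀ᶠ t in 𝓝[<] (explosion fun k => (w k).2).toNNReal,
          ∃ y ∈ C j, minimalPath (fun k => (w k).1) (fun k => (w k).2) t = some y) ∧
        ∃ l > j, ∃ y ∈ C l,
          HasLeftLimit (minimalPath (fun k => (w k).1) (fun k => (w k).2))
            (explosion fun k => (w k).2).toNNReal y

/-- The `n`-th explosion time of a path pasted together from pieces, where the `i`-th piece has the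
holding times `S i 0, S i 1, …`. -/
def explosionTime (S : ℕ → ℕ → ℝ≥0∞) (n : ℕ) : ℝ≥0∞ := ∑ i ∈ Finset.range n, explosion (S i)

/-- The double explosion time, the limit of the explosion times. -/
def doubleExplosionTime (S : ℕ → ℕ → ℝ≥0∞) : ℝ≥0∞ := ⨆ n, explosionTime S n

open Classical in
/-- The pasted path: on the interval from `explosionTime S i` to `explosionTime S (i + 1)` it
follows the `i`-th piece, and from the double explosion time onwards it is at the cemetery. -/
def stratifiedPath {E : Type*} (Y : ℕ → ℕ → E) (S : ℕ → ℕ → ℝ≥0∞) (t : ℝ≥0) : Option E :=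
  if h : ∃ i, explosionTime S i ≤ t ∧ (t : ℝ≥0∞) < explosionTime S (i + 1) then
    minimalPath (Y h.choose) (S h.choose) (t - (explosionTime S h.choose).toNNReal)
  else none

/-- The information contained in the pieces with index less than `i`, that is, in the pasted path
up to its `i`-th explosion time. -/
abbrev past {E Ω : Type*} [MeasurableSpace E] (Y : ℕ → ℕ → Ω → E) (S : ℕ → ℕ → Ω → ℝ≥0∞) (i : ℕ) :
    MeasurableSpace Ω :=
  ⨆ j < i, ⨆ k, (MeasurableSpace.comap (Y j k) inferInstance ⊔
    MeasurableSpace.comap (S j k) inferInstance)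

/-- `Y i k` and `S i k` are the `k`-th state and the `k`-th holding time of the `i`-th minimal
process in the construction of a stratified jump process with generator `L` and initial
distribution `ν`. Nothing is asked of the `i`-th process where the `i`-th explosion time is
infinite. The fields `holding_pos` and `state_ne` (holding times are positive, and a jump changes
the state) hold almost surely by the other fields; they are imposed at every sample point, so that
the path determines its own explosion times. -/
structure IsStratifiedJumpProcess {E Ω : Type*} [TopologicalSpace E] [MeasurableSpace E]
    [MeasurableSpace Ω] (L : E → E → ℝ) (ν : Measure E) (μ : Measure Ω)
    (Y : ℕ → ℕ → Ω → E) (S : ℕ → ℕ → Ω → ℝ≥0∞) : Prop where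
  measurable_state : ∀ i k, Measurable (Y i k)
  measurable_holding : ∀ i k, Measurable (S i k)
  /-- The initial state has distribution `ν`. -/
  initial : Measure.map (Y 0 0) μ = ν
  /-- Given that the `i`-th explosion time is finite and that the process is at `x` at that time,
  the `i`-th process is a minimal process starting at `x`, independent of the past. -/
  restart : ∀ (i : ℕ) (x : E) (A : Set Ω), MeasurableSet[past Y S i] A →
    μ (A ∩ {ω | explosionTime (fun i k => S i k ω) i < ⊤ ∧ Y i 0 ω = x}) ≠ 0 →
    IsMinimalProcess L (Measure.dirac x)
      (ProbabilityTheory.cond μ (A ∩ {ω | explosionTime (fun i k => S i k ω) i < ⊤ ∧ Y i 0 ω = x}))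
      (Y i) (S i)
  /-- At a finite explosion time the process is at the limit of the process that explodes. -/
  limit : ∀ i, ∀ᵐ ω ∂μ, explosionTime (fun i k => S i k ω) (i + 1) < ⊤ →
    ∀ y, HasLeftLimit (minimalPath (fun k => Y i k ω) (fun k => S i k ω))
      (explosion fun k => S i k ω).toNNReal y → Y (i + 1) 0 ω = y
  holding_pos : ∀ i k ω,
    explosionTime (fun i k => S i k ω) i + jumpTime (fun k => S i k ω) k < ⊤ → 0 < S i k ω
  state_ne : ∀ i k ω,
    explosionTime (fun i k => S i k ω) i + jumpTime (fun k => S i k ω) (k + 1) < ⊤ →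
      Y i (k + 1) ω ≠ Y i k ω

/-- The stratified jump process itself, with values in `E` and the cemetery point `none`. -/
def stratifiedProcess {E Ω : Type*} (Y : ℕ → ℕ → Ω → E) (S : ℕ → ℕ → Ω → ℝ≥0∞)
    (t : ℝ≥0) (ω : Ω) : Option E :=
  stratifiedPath (fun i k => Y i k ω) (fun i k => S i k ω) t

theorem jumpTime_mono (S : ℕ → ℝ≥0∞) : Monotone (jumpTime S) := fun _ _ h =>
  Finset.sum_le_sum_of_subset (Finset.range_mono h)

theorem explosionTime_mono (S : ℕ → ℕ → ℝ≥0∞) : Monotone (explosionTime S) := fun _ _ h =>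
  Finset.sum_le_sum_of_subset (Finset.range_mono h)

theorem index_unique {T : ℕ → ℝ≥0∞} (hT : Monotone T) {t : ℝ≥0∞} {i j : ℕ}
    (hi : T i ≤ t ∧ t < T (i + 1)) (hj : T j ≤ t ∧ t < T (j + 1)) : i = j := by
  rcases lt_trichotomy i j with h | h | h
  · exact absurd (lt_of_lt_of_le hi.2 (hT h)) (not_lt.2 hj.1)
  · exact h
  · exact absurd (lt_of_lt_of_le hj.2 (hT h)) (not_lt.2 hi.1)

theorem minimalPath_eq_some {E : Type*} (Y : ℕ → E) (S : ℕ → ℝ≥0∞) (t : ℝ≥0) (x : E) :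
    minimalPath Y S t = some x ↔
      ∃ k, (jumpTime S k ≤ t ∧ (t : ℝ≥0∞) < jumpTime S (k + 1)) ∧ Y k = x := by
  unfold minimalPath
  split_ifs with h
  · constructor
    · intro hx
      exact ⟨_, h.choose_spec, Option.some.inj hx⟩
    · rintro ⟨k, hk, rfl⟩
      rw [index_unique (jumpTime_mono S) h.choose_spec hk]
  · simp only [false_iff]
    rintro ⟨k, hk, -⟩
    exact h ⟨k, hk⟩

theorem stratifiedPath_eq_some {E : Type*} (Y : ℕ → ℕ → E) (S : ℕ → ℕ → ℝ≥0∞) (t : ℝ≥0) (x : E) :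
    stratifiedPath Y S t = some x ↔
      ∃ i, (explosionTime S i ≤ t ∧ (t : ℝ≥0∞) < explosionTime S (i + 1)) ∧
        minimalPath (Y i) (S i) (t - (explosionTime S i).toNNReal) = some x := by
  unfold stratifiedPath
  split_ifs with h
  · constructor
    · intro hx
      exact ⟨_, h.choose_spec, hx⟩
    · rintro ⟨i, hi, hx⟩
      rw [index_unique (explosionTime_mono S) h.choose_spec hi]
      exact hx
  · simp only [false_iff]
    rintro ⟨i, hi, -⟩
    exact h ⟨i, hi⟩

theorem measurable_stratifiedProcess {E Ω : Type*} [Countable E] [MeasurableSpace E]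
    [MeasurableSingletonClass E] [MeasurableSpace Ω]
    {Y : ℕ → ℕ → Ω → E} {S : ℕ → ℕ → Ω → ℝ≥0∞}
    (hY : ∀ i k, Measurable (Y i k)) (hS : ∀ i k, Measurable (S i k)) (t : ℝ≥0) :
    Measurable[_, ⊤] (stratifiedProcess Y S t) := by
  have hJ : ∀ i k, Measurable fun ω => jumpTime (fun k => S i k ω) k := fun i k =>
    Finset.measurable_sum _ fun j _ => hS i j
  have hX : ∀ i, Measurable fun ω => explosion (fun k => S i k ω) := fun i =>
    Measurable.iSup (hJ i)
  have hT : ∀ i, Measurable fun ω => explosionTime (fun i k => S i k ω) i := fun i =>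
    Finset.measurable_sum _ fun j _ => hX j
  have key : ∀ x : E, MeasurableSet (stratifiedProcess Y S t ⁻¹' {some x}) := by
    intro x
    have : stratifiedProcess Y S t ⁻¹' {some x} =
        ⋃ i, ⋃ k, {ω | ((explosionTime (fun i k => S i k ω) i ≤ t ∧
          (t : ℝ≥0∞) < explosionTime (fun i k => S i k ω) (i + 1)) ∧
          (jumpTime (fun k => S i k ω) k ≤
              ((t - (explosionTime (fun i k => S i k ω) i).toNNReal : ℝ≥0) : ℝ≥0∞) ∧
            ((t - (explosionTime (fun i k => S i k ω) i).toNNReal : ℝ≥0) : ℝ≥0∞) <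
              jumpTime (fun k => S i k ω) (k + 1)) ∧ Y i k ω = x)} := by
      ext ω
      simp only [mem_preimage, mem_singleton_iff, stratifiedProcess, stratifiedPath_eq_some,
        minimalPath_eq_some, mem_iUnion, mem_ofPred_eq]
      constructor
      · rintro ⟨i, hi, k, hk, hx⟩
        exact ⟨i, k, hi, hk, hx⟩
      · rintro ⟨i, k, hi, hk, hx⟩
        exact ⟨i, hi, k, hk, hx⟩
    rw [this]
    refine MeasurableSet.iUnion fun i => MeasurableSet.iUnion fun k => ?_
    have hd : Measurable fun ω =>
        ((t - (explosionTime (fun i k => S i k ω) i).toNNReal : ℝ≥0) : ℝ≥0∞) :=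
      (measurable_const.sub (hT i).ennreal_toNNReal).coe_nnreal_ennreal
    exact ((measurableSet_le (hT i) measurable_const).inter
      (measurableSet_lt measurable_const (hT (i + 1)))).inter
      (((measurableSet_le (hJ i k) hd).inter (measurableSet_lt hd (hJ i (k + 1)))).inter
        (hY i k (measurableSet_singleton x)))
  have hnone : MeasurableSet (stratifiedProcess Y S t ⁻¹' {none}) := by
    have : stratifiedProcess Y S t ⁻¹' {none} =
        (⋃ x : E, stratifiedProcess Y S t ⁻¹' {some x})ᶜ := by
      ext ω
      cases h : stratifiedProcess Y S t ω <;> simp [h]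
    rw [this]
    exact (MeasurableSet.iUnion key).compl
  intro B _
  rw [← biUnion_preimage_singleton]
  refine MeasurableSet.biUnion (to_countable B) fun z _ => ?_
  cases z with
  | none => exact hnone
  | some x => exact key x

/-- The filtration generated by a process with values in a countable set, all of whose subsets are
measurable. -/
def pathFiltration {F Ω : Type*} {m : MeasurableSpace Ω} (Z : ℝ≥0 → Ω → F)
    (hZ : ∀ t, Measurable[m, ⊤] (Z t)) : Filtration ℝ≥0 m where
  seq t := ⨆ s ≤ t, MeasurableSpace.comap (Z s) ⊤
  mono' _ _ h := biSup_mono fun _ hs => hs.trans h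
  le' _ := iSup₂_le fun s _ => (hZ s).comap_le

theorem IsStratifiedJumpProcess.measurable_process {E Ω : Type*} [Countable E] [TopologicalSpace E]
    [MeasurableSpace E] [MeasurableSingletonClass E] [MeasurableSpace Ω] {L : E → E → ℝ}
    {ν : Measure E} {μ : Measure Ω} {Y : ℕ → ℕ → Ω → E} {S : ℕ → ℕ → Ω → ℝ≥0∞}
    (h : IsStratifiedJumpProcess L ν μ Y S) (t : ℝ≥0) :
    Measurable[_, ⊤] (stratifiedProcess Y S t) :=
  measurable_stratifiedProcess h.measurable_state h.measurable_holding t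

/-- The extension of a real function by the value zero at the cemetery point. -/
def extendZero {E : Type*} (g : E → ℝ) (z : Option E) : ℝ := z.elim 0 g

/-- The process `f (Z t) - f (Z 0) - ∫ s in 0..t, L f (Z s)`. -/
def dynkinProcess {E Ω : Type*} (L : E → E → ℝ) (f : E → ℝ) (Z : ℝ≥0 → Ω → Option E)
    (t : ℝ≥0) (ω : Ω) : ℝ :=
  extendZero f (Z t ω) - extendZero f (Z 0 ω) -
    ∫ s in (0 : ℝ)..t, extendZero (genApply L f) (Z s.toNNReal ω)

end StratifiedJump

end

/-! Let $R_{i,k}$ (`epoch`) be the time of the $k$-th jump of the $i$-th piece. Between $R_{i,k}$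
and $R_{i,k+1}$ the process sits in one state $x$, so the stopped process changes by
$1_{\{R_{i,k+1}\le t\}}(f(Y_{i,k+1})-f(x))-(t\wedge R_{i,k+1}-t\wedge R_{i,k})\hat{\mathcal L}f(x)$
(`dynkinProcess_epoch_succ_sub`). Given the previous pieces, the states so far and the earlier
holding times, the holding time $U$ is exponential with rate $q=\hat{\mathcal L}_x$ and independent
of the next state. Since $\hat{\mathcal L}f(x)=q\sum_y p_{x,y}(f(y)-f(x))$ and $P(r+U\le
t)=q\,E[t\wedge(r+U)-t\wedge r]$, this change has mean zero (`setIntegral_jump_eq_zero`).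

To pass to $\mathcal F^Z_s$, let $N_t$ be the change and $A\in\mathcal F^Z_s$. Where $R_{i,k+1}\le
s$, already $N_t=N_s$. Where $s<R_{i,k+1}$ and the visited states are prescribed, $A$ coincides with
an event $A'$ that ignores the current holding time (`exists_pastHoldings_inter_eq`). So $N_t-N_s$
has the same integral over $A$ as over $A'$, where $N_t$ and $N_s$ integrate to zero separately. The
memoryless property is never invoked as such.

Induction on $k$ gives constant integrals for the process stopped at $R_{i,k}$. The limit
$k\to\infty$ reaches $T_{i+1}$ by dominated convergence: the stratification supplies a left limit at
a finite explosion time, the next piece starts there, and $f$ is continuous. Induction on $i$ then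
covers every $T_n$, and $n\to\infty$ covers the unstopped process when $T=\infty$.

Adaptedness is separate: the path is right-continuous for the discrete topology, hence progressively
measurable, and the $T_n$ are stopping times because every jump is visible in the path. -/

namespace StratifiedJump

/-! ### Jump epochs of a pasted path -/

section Path

variable {E : Type*}

/-- The `k`-th jumping time of the `i`-th piece of a pasted path, measured from time zero. -/
noncomputable def epoch (S : ℕ → ℕ → ℝ≥0∞) (i k : ℕ) : ℝ≥0∞ := explosionTime S i + jumpTime (S i) k

theorem epoch_zero (S : ℕ → ℕ → ℝ≥0∞) (i : ℕ) : epoch S i 0 = explosionTime S i := by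
  simp [epoch, jumpTime]

theorem epoch_succ (S : ℕ → ℕ → ℝ≥0∞) (i k : ℕ) : epoch S i (k + 1) = epoch S i k + S i k := by
  simp [epoch, jumpTime, Finset.sum_range_succ, add_assoc]

theorem explosionTime_zero (S : ℕ → ℕ → ℝ≥0∞) : explosionTime S 0 = 0 := by
  simp [explosionTime]

theorem explosionTime_succ (S : ℕ → ℕ → ℝ≥0∞) (i : ℕ) :
    explosionTime S (i + 1) = explosionTime S i + explosion (S i) := by
  simp [explosionTime, Finset.sum_range_succ]

theorem epoch_mono (S : ℕ → ℕ → ℝ≥0∞) (i : ℕ) : Monotone (epoch S i) := fun _ _ h =>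
  add_le_add le_rfl (jumpTime_mono _ h)

theorem explosionTime_le_epoch (S : ℕ → ℕ → ℝ≥0∞) (i k : ℕ) : explosionTime S i ≤ epoch S i k :=
  le_self_add

theorem iSup_epoch (S : ℕ → ℕ → ℝ≥0∞) (i : ℕ) : ⨆ k, epoch S i k = explosionTime S (i + 1) := by
  rw [explosionTime_succ, explosion, ENNReal.add_iSup]
  rfl

theorem epoch_le_explosionTime (S : ℕ → ℕ → ℝ≥0∞) (i k : ℕ) :
    epoch S i k ≤ explosionTime S (i + 1) := by
  rw [← iSup_epoch]
  exact le_iSup _ k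

theorem tendsto_epoch (S : ℕ → ℕ → ℝ≥0∞) (i : ℕ) :
    Tendsto (epoch S i) atTop (𝓝 (explosionTime S (i + 1))) := by
  rw [← iSup_epoch]
  exact tendsto_atTop_iSup (epoch_mono S i)

theorem exists_epoch_of_lt {T : ℕ → ℝ≥0∞} {t : ℝ≥0∞} (h0 : T 0 ≤ t) (h : t < ⨆ k, T k) :
    ∃ k, T k ≤ t ∧ t < T (k + 1) := by
  classical
  have hex : ∃ k, t < T k := lt_iSup_iff.1 h
  obtain ⟨k, hk⟩ : ∃ k, Nat.find hex = k + 1 := by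
    refine Nat.exists_eq_succ_of_ne_zero fun h => ?_
    have := Nat.find_spec hex
    rw [h] at this
    exact absurd h0 (not_le.2 this)
  refine ⟨k, not_lt.1 (Nat.find_min hex (by omega)), ?_⟩
  rw [← hk]
  exact Nat.find_spec hex

theorem exists_epoch_of_lt_doubleExplosionTime {S : ℕ → ℕ → ℝ≥0∞} {t : ℝ≥0∞}
    (h : t < doubleExplosionTime S) : ∃ i k, epoch S i k ≤ t ∧ t < epoch S i (k + 1) := by
  obtain ⟨i, hi, hi'⟩ := exists_epoch_of_lt (by simp [explosionTime]) h
  rw [← iSup_epoch] at hi'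
  rw [← epoch_zero] at hi
  exact ⟨i, exists_epoch_of_lt hi hi'⟩

theorem lt_doubleExplosionTime {S : ℕ → ℕ → ℝ≥0∞} {t : ℝ≥0∞} {i k : ℕ} (h : t < epoch S i k) :
    t < doubleExplosionTime S :=
  h.trans_le ((epoch_le_explosionTime S i k).trans (le_iSup (explosionTime S) (i + 1)))

theorem stratifiedPath_eq_some_iff (Y : ℕ → ℕ → E) (S : ℕ → ℕ → ℝ≥0∞) (t : ℝ≥0) (x : E) :
    stratifiedPath Y S t = some x ↔
      ∃ i k, (epoch S i k ≤ t ∧ (t : ℝ≥0∞) < epoch S i (k + 1)) ∧ Y i k = x := by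
  -- The truncated subtraction is exact here because the explosion time is at most `t`, so
  -- conditions on the local clock translate to the global one.
  have key : ∀ i, explosionTime S i ≤ t → ∀ k, ((jumpTime (S i) k ≤
      ((t - (explosionTime S i).toNNReal : ℝ≥0) : ℝ≥0∞) ↔ epoch S i k ≤ t) ∧
      (((t - (explosionTime S i).toNNReal : ℝ≥0) : ℝ≥0∞) < jumpTime (S i) k ↔
        (t : ℝ≥0∞) < epoch S i k)) := by
    intro i hi k
    have hfin : explosionTime S i ≠ ⊤ := ne_top_of_le_ne_top ENNReal.coe_ne_top hi
    have : (jumpTime (S i) k ≤ ((t - (explosionTime S i).toNNReal : ℝ≥0) : ℝ≥0∞) ↔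
        epoch S i k ≤ t) := by
      rw [ENNReal.coe_sub, ENNReal.coe_toNNReal hfin, epoch, add_comm]
      exact ENNReal.le_sub_iff_add_le_right hfin hi
    exact ⟨this, by rw [← not_le, this, not_le]⟩
  rw [stratifiedPath_eq_some]
  constructor
  · rintro ⟨i, ⟨hi, -⟩, h⟩
    obtain ⟨k, ⟨hk, hk'⟩, rfl⟩ := (minimalPath_eq_some _ _ _ _).1 h
    exact ⟨i, k, ⟨((key i hi k).1).1 hk, ((key i hi _).2).1 hk'⟩, rfl⟩
  · rintro ⟨i, k, ⟨hk, hk'⟩, rfl⟩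
    have hi := (explosionTime_le_epoch S i k).trans hk
    exact ⟨i, ⟨hi, hk'.trans_le (epoch_le_explosionTime S i _)⟩,
      (minimalPath_eq_some _ _ _ _).2 ⟨k, ⟨((key i hi k).1).2 hk, ((key i hi _).2).2 hk'⟩, rfl⟩⟩

theorem stratifiedPath_of_mem {Y : ℕ → ℕ → E} {S : ℕ → ℕ → ℝ≥0∞} {t : ℝ≥0} {i k : ℕ}
    (h : epoch S i k ≤ t) (h' : (t : ℝ≥0∞) < epoch S i (k + 1)) :
    stratifiedPath Y S t = some (Y i k) :=
  (stratifiedPath_eq_some_iff _ _ _ _).2 ⟨i, k, ⟨h, h'⟩, rfl⟩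

theorem stratifiedPath_of_doubleExplosionTime_le {Y : ℕ → ℕ → E} {S : ℕ → ℕ → ℝ≥0∞} {t : ℝ≥0}
    (h : doubleExplosionTime S ≤ t) : stratifiedPath Y S t = none := by
  rw [Option.eq_none_iff_forall_ne_some]
  intro x hx
  obtain ⟨i, k, hk, -⟩ := (stratifiedPath_eq_some_iff _ _ _ _).1 hx
  exact absurd h (not_le.2 (lt_doubleExplosionTime hk.2))

/-- A pasted path is right-continuous for the discrete topology. -/
theorem eventually_stratifiedPath_eq (Y : ℕ → ℕ → E) (S : ℕ → ℕ → ℝ≥0∞) (t : ℝ≥0) :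
    ∀ᶠ u in 𝓝[≥] t, stratifiedPath Y S u = stratifiedPath Y S t := by
  rcases lt_or_ge (t : ℝ≥0∞) (doubleExplosionTime S) with h | h
  · obtain ⟨i, k, hk, hk'⟩ := exists_epoch_of_lt_doubleExplosionTime h
    have : ∀ᶠ u : ℝ≥0 in 𝓝[≥] t, (u : ℝ≥0∞) < epoch S i (k + 1) :=
      nhdsWithin_le_nhds ((ENNReal.continuous_coe.tendsto t).eventually_lt_const hk')
    filter_upwards [this, self_mem_nhdsWithin] with u hu htu
    rw [stratifiedPath_of_mem hk hk',
      stratifiedPath_of_mem (hk.trans (ENNReal.coe_le_coe.2 htu)) hu]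
  · filter_upwards [self_mem_nhdsWithin] with u hu
    rw [stratifiedPath_of_doubleExplosionTime_le h,
      stratifiedPath_of_doubleExplosionTime_le (h.trans (ENNReal.coe_le_coe.2 hu))]

end Path

/-! ### Progressive measurability and bounds for the Dynkin process -/

section RightContinuous

variable {Ω F : Type*} [MeasurableSpace Ω]

/-- A process that is right-continuous for the discrete topology is progressively measurable. -/
theorem measurable_uncurry_of_eventually_eq {X : ℝ≥0 → Ω → F} {t : ℝ≥0}
    (hX : ∀ s ≤ t, Measurable[_, ⊤] (X s)) (hr : ∀ ω s, ∀ᶠ u in 𝓝[≥] s, X u ω = X s ω)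
    (h : F → ℝ) : Measurable fun p : ℝ≥0 × Ω => h (X (min p.1 t) p.2) := by
  have hh : @Measurable F ℝ ⊤ _ h := fun _ _ => trivial
  have key : ∀ (q : ℕ → ℝ≥0) (n : ℝ≥0 → ℕ), Measurable n →
      Measurable fun p : ℝ≥0 × Ω => h (X (min (q (n p.1)) t) p.2) := by
    intro q n hn
    have h1 : Measurable fun p : ℕ × Ω => h (X (min (q p.1) t) p.2) :=
      measurable_from_prod_countable_right fun j => by
        have := hh.comp (hX (min (q j) t) (min_le_right _ _))
        exact this
    exact h1.comp ((hn.comp measurable_fst).prodMk measurable_snd)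
  -- Grid points of mesh `1 / (m + 1)` to the right of `s`. They take countably many values and tend
  -- to `s` from the right, where the path is locally constant.
  let d : ℕ → ℝ≥0 → ℝ≥0 := fun m s => ((⌊s * (m + 1)⌋₊ + 1 : ℕ) : ℝ≥0) / (m + 1)
  have hd : ∀ m s, s ≤ d m s := by
    intro m s
    rw [le_div_iff₀ (by positivity)]
    push_cast
    exact (Nat.lt_floor_add_one _).le
  have hd' : ∀ m s, d m s ≤ s + 1 / (m + 1) := by
    intro m s
    rw [div_le_iff₀ (by positivity), add_mul, div_mul_cancel₀ _ (by positivity)]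
    push_cast
    gcongr
    exact Nat.floor_le (by positivity)
  have hlim : ∀ s, Tendsto (fun m => d m s) atTop (𝓝[≥] s) := by
    intro s
    refine tendsto_nhdsWithin_iff.2 ⟨?_, Eventually.of_forall fun m => hd m s⟩
    refine tendsto_of_tendsto_of_tendsto_of_le_of_le tendsto_const_nhds ?_
      (fun m => hd m s) (fun m => hd' m s)
    have := (tendsto_one_div_add_atTop_nhds_zero_nat (𝕜 := ℝ≥0)).const_add s
    simpa using this
  refine measurable_of_tendsto_metrizable (f := fun m p => h (X (min (d m p.1) t) p.2)) ?_ ?_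
  · exact fun m => key (fun j => ((j + 1 : ℕ) : ℝ≥0) / (m + 1)) (fun s => ⌊s * (m + 1)⌋₊)
      (Nat.measurable_floor.comp (measurable_id.mul_const _))
  · rw [tendsto_pi_nhds]
    rintro ⟨s, ω⟩
    refine tendsto_const_nhds.congr' ?_
    rcases lt_or_ge s t with hst | hst
    · have h1 : ∀ᶠ u in 𝓝[≥] s, X u ω = X s ω ∧ u < t :=
        (hr ω s).and (nhdsWithin_le_nhds (eventually_lt_nhds hst))
      filter_upwards [(hlim s).eventually h1] with m hm
      simp only [min_eq_left hst.le, min_eq_left hm.2.le, hm.1]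
    · filter_upwards with m
      simp only [min_eq_right hst, min_eq_right (hst.trans (hd m s))]

end RightContinuous

section Dynkin

variable {E Ω : Type*}

theorem measurable_dynkinProcess_comp [MeasurableSpace Ω] {X : ℝ≥0 → Ω → Option E} {t : ℝ≥0}
    (hX : ∀ s ≤ t, Measurable[_, ⊤] (X s)) (hr : ∀ ω s, ∀ᶠ u in 𝓝[≥] s, X u ω = X s ω)
    (L : E → E → ℝ) (f : E → ℝ) {τ : Ω → ℝ≥0} (hτ : Measurable τ) (hτt : ∀ ω, τ ω ≤ t) :
    Measurable fun ω => dynkinProcess L f X (τ ω) ω := by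
  have hf := measurable_uncurry_of_eventually_eq hX hr (extendZero f)
  have hg := measurable_uncurry_of_eventually_eq hX hr (extendZero (genApply L f))
  have h1 : Measurable fun ω => extendZero f (X (τ ω) ω) := by
    simpa [Function.comp_def, hτt] using hf.comp (hτ.prodMk measurable_id)
  have h2 : Measurable fun ω => extendZero f (X 0 ω) := by
    simpa [Function.comp_def] using
      hf.comp ((measurable_const (a := (0 : ℝ≥0))).prodMk measurable_id)
  refine (h1.sub h2).sub ?_
  -- The random endpoint is moved into an indicator so that measurability of parametrized integrals
  -- over a fixed domain applies. Capping the time at `t` keeps the integrand measurable when the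
  -- ambient σ-algebra knows only the path up to `t`.
  have h3 : (fun ω => ∫ s in (0 : ℝ)..τ ω, extendZero (genApply L f) (X s.toNNReal ω)) =
      fun ω => ∫ s, {p : Ω × ℝ | 0 < p.2 ∧ p.2 ≤ τ p.1}.indicator
        (fun p => extendZero (genApply L f) (X (min p.2.toNNReal t) p.1)) (ω, s) := by
    ext ω
    rw [intervalIntegral.integral_of_le (τ ω).coe_nonneg, ← integral_indicator measurableSet_Ioc]
    congr 1 with s
    by_cases hs : s ∈ Ioc (0 : ℝ) (τ ω)
    · have : s.toNNReal ≤ t := (Real.toNNReal_le_iff_le_coe.2 hs.2).trans (hτt ω)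
      rw [indicator_of_mem hs, indicator_of_mem (by exact hs), min_eq_left this]
    · rw [indicator_of_notMem hs, indicator_of_notMem (by exact hs)]
  rw [h3]
  refine (StronglyMeasurable.integral_prod_right (f := fun ω s =>
    {p : Ω × ℝ | 0 < p.2 ∧ p.2 ≤ τ p.1}.indicator
        (fun p => extendZero (genApply L f) (X (min p.2.toNNReal t) p.1)) (ω, s)) ?_).measurable
  refine Measurable.stronglyMeasurable (Measurable.indicator ?_ ?_)
  · exact hg.comp ((measurable_snd.real_toNNReal).prodMk measurable_fst)
  · exact (measurableSet_lt measurable_const measurable_snd).inter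
      (measurableSet_le measurable_snd (hτ.comp measurable_fst).coe_nnreal_real)

theorem abs_extendZero_le {f : E → ℝ} {K : ℝ} (hK : 0 ≤ K) (hf : ∀ x, |f x| ≤ K) (z : Option E) :
    |extendZero f z| ≤ K := by
  cases z with
  | none => simpa [extendZero] using hK
  | some x => exact hf x

theorem abs_dynkinProcess_le {L : E → E → ℝ} {f : E → ℝ} {K K' : ℝ} (hK : 0 ≤ K) (hK' : 0 ≤ K')
    (hf : ∀ x, |f x| ≤ K) (hg : ∀ x, |genApply L f x| ≤ K') (X : ℝ≥0 → Ω → Option E) {s t : ℝ≥0}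
    (hst : s ≤ t) (ω : Ω) : |(dynkinProcess L f X s ω)| ≤ K + K + K' * t := by
  have h1 := abs_extendZero_le hK hf (X s ω)
  have h2 := abs_extendZero_le hK hf (X 0 ω)
  have h3 : |∫ u in (0 : ℝ)..s, extendZero (genApply L f) (X u.toNNReal ω)| ≤ K' * t := by
    refine (intervalIntegral.norm_integral_le_of_norm_le_const (C := K')
      (f := fun u : ℝ => extendZero (genApply L f) (X u.toNNReal ω))
      fun u _ => abs_extendZero_le hK' hg (X u.toNNReal ω)).trans ?_
    rw [sub_zero, abs_of_nonneg s.coe_nonneg]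
    gcongr
  unfold dynkinProcess
  calc _ ≤ |extendZero f (X s ω) - extendZero f (X 0 ω)| + _ := abs_sub _ _
    _ ≤ (|extendZero f (X s ω)| + |extendZero f (X 0 ω)|) + _ := by gcongr; exact abs_sub _ _
    _ ≤ _ := by gcongr

theorem intervalIntegrable_path {X : ℝ≥0 → Ω → Option E}
    (hr : ∀ ω s, ∀ᶠ u in 𝓝[≥] s, X u ω = X s ω) {g : E → ℝ} {K : ℝ} (hg : ∀ x, |g x| ≤ K)
    (hK : 0 ≤ K) (a b : ℝ) (ω : Ω) :
    IntervalIntegrable (fun s : ℝ => extendZero g (X s.toNNReal ω)) volume a b := by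
  set c : ℝ≥0 := (max a b).toNNReal
  -- A single path is treated as a process on a one-point sample space.
  have hm : Measurable fun p : ℝ≥0 × Unit => extendZero g (X (min p.1 c) ω) :=
    measurable_uncurry_of_eventually_eq (X := fun t (_ : Unit) => X t ω)
      (fun s _ => measurable_const) (fun _ => hr ω) _
  have hm' : Measurable fun s : ℝ => extendZero g (X (min s.toNNReal c) ω) :=
    hm.comp (measurable_real_toNNReal.prodMk (measurable_const (a := ())))
  have : IntervalIntegrable (fun s : ℝ => extendZero g (X (min s.toNNReal c) ω)) volume a b := by
    refine (intervalIntegrable_const (c := K)).mono_fun hm'.aestronglyMeasurable ?_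
    filter_upwards with s
    rw [Real.norm_eq_abs, Real.norm_eq_abs, abs_of_nonneg hK]
    exact abs_extendZero_le hK hg _
  refine this.congr fun s hs => ?_
  have h2 : s.toNNReal ≤ c := Real.toNNReal_le_toNNReal hs.2
  simp only [min_eq_left h2]

end Dynkin

/-! ### Explosion times are stopping times -/

theorem exists_mem_dense_between {D : Set ℝ≥0} (hD : Dense D) {a b : ℝ≥0∞} (h : a < b) :
    ∃ q ∈ D, a < q ∧ (q : ℝ≥0∞) < b := by
  obtain ⟨r, har, hrb⟩ := ENNReal.lt_iff_exists_nnreal_btwn.1 h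
  obtain ⟨r', hr, hrb'⟩ := ENNReal.lt_iff_exists_nnreal_btwn.1 hrb
  obtain ⟨q, hq, hq1, hq2⟩ := hD.exists_between (ENNReal.coe_lt_coe.1 hr)
  exact ⟨q, hq, har.trans (ENNReal.coe_lt_coe.2 hq1), (ENNReal.coe_lt_coe.2 hq2).trans hrb'⟩

theorem measurable_min_of_measurableSet_le {Ω : Type*} {m : MeasurableSpace Ω} {τ : Ω → ℝ≥0∞}
    {t : ℝ≥0} (h : ∀ a < t, MeasurableSet {ω | τ ω ≤ a}) :
    Measurable fun ω => min (t : ℝ≥0∞) (τ ω) := by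
  refine measurable_of_Iic fun a => ?_
  rcases le_or_gt (t : ℝ≥0∞) a with hta | hta
  · convert MeasurableSet.univ
    ext ω
    simp [hta]
  · lift a to ℝ≥0 using (hta.trans ENNReal.coe_lt_top).ne
    convert h a (ENNReal.coe_lt_coe.1 hta) using 1
    ext ω
    simp [not_le.2 (ENNReal.coe_lt_coe.1 hta)]

section Stopping

variable {E Ω : Type*} [TopologicalSpace E] [MeasurableSpace E] [MeasurableSpace Ω]
  {L : E → E → ℝ} {ν : Measure E} {μ : Measure Ω} {Y : ℕ → ℕ → Ω → E} {S : ℕ → ℕ → Ω → ℝ≥0∞}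

namespace IsStratifiedJumpProcess

theorem epoch_lt_epoch_succ (h : IsStratifiedJumpProcess L ν μ Y S) {i k : ℕ} {ω : Ω}
    (hk : epoch (fun i k => S i k ω) i k < ⊤) :
    epoch (fun i k => S i k ω) i k < epoch (fun i k => S i k ω) i (k + 1) := by
  rw [epoch_succ]
  exact ENNReal.lt_add_right hk.ne (h.holding_pos i k ω hk).ne'

theorem measurable_epoch (h : IsStratifiedJumpProcess L ν μ Y S) (i k : ℕ) :
    Measurable fun ω => epoch (fun i k => S i k ω) i k :=
  (Finset.measurable_sum _ fun j _ => Measurable.iSup fun _ =>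
    Finset.measurable_sum _ fun l _ => h.measurable_holding j l).add
    (Finset.measurable_sum _ fun l _ => h.measurable_holding i l)

variable [Countable E] [MeasurableSingletonClass E]

/-- Once the previous epoch is known to have passed, the next one has occurred by `t` exactly when
the path takes two different values at later times up to `t`. A jump always changes the state and
the new state is held for a positive time, so countably many times suffice to detect it. -/
theorem measurableSet_epoch_succ_le (h : IsStratifiedJumpProcess L ν μ Y S) {i k : ℕ}
    (hk : ∀ t : ℝ≥0, MeasurableSet[pathFiltration _ h.measurable_process t]
      {ω | epoch (fun i k => S i k ω) i k ≤ t}) (t : ℝ≥0) :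
    MeasurableSet[pathFiltration _ h.measurable_process t]
      {ω | epoch (fun i k => S i k ω) i (k + 1) ≤ t} := by
  obtain ⟨D, hDc, hDd⟩ := TopologicalSpace.exists_countable_dense ℝ≥0
  set 𝓕 := pathFiltration _ h.measurable_process
  have heq : {ω | epoch (fun i k => S i k ω) i (k + 1) ≤ t} =
      ⋃ q ∈ D ∩ {q | q < t}, {ω | epoch (fun i k => S i k ω) i k ≤ q} ∩
        ⋃ r ∈ insert t D ∩ {r | q < r ∧ r ≤ t},
          {ω | stratifiedProcess Y S q ω = stratifiedProcess Y S r ω}ᶜ := by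
    ext ω
    simp only [mem_ofPred_eq, mem_iUnion, mem_inter_iff, exists_prop, mem_compl_iff]
    constructor
    · intro hle
      have hlt : epoch (fun i k => S i k ω) i (k + 1) < ⊤ := hle.trans_lt ENNReal.coe_lt_top
      have hlt' : epoch (fun i k => S i k ω) i k < ⊤ := (epoch_mono _ i k.le_succ).trans_lt hlt
      have h1 := h.epoch_lt_epoch_succ hlt'
      have h2 := h.epoch_lt_epoch_succ hlt
      have hne := h.state_ne i k ω hlt
      obtain ⟨q, hqD, hq1', hq2'⟩ := exists_mem_dense_between hDd h1
      have hqt : q < t := ENNReal.coe_lt_coe.1 (hq2'.trans_le hle)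
      -- If the jump happens exactly at `t`, no other time up to `t` sees the new state; this is why
      -- `t` is added to `D`.
      obtain ⟨r, hrD, hr1, hr2, hrt⟩ : ∃ r ∈ insert t D,
          epoch (fun i k => S i k ω) i (k + 1) ≤ r ∧
          (r : ℝ≥0∞) < epoch (fun i k => S i k ω) i (k + 1 + 1) ∧ r ≤ t := by
        rcases hle.eq_or_lt with heq | hlt2
        · exact ⟨t, mem_insert _ _, heq.le, heq ▸ h2, le_rfl⟩
        · have hm := lt_min h2 hlt2
          obtain ⟨r, hrD, hr1', hr2'⟩ := exists_mem_dense_between hDd hm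
          exact ⟨r, mem_insert_of_mem _ hrD, hr1'.le, hr2'.trans_le (min_le_left _ _),
            (ENNReal.coe_lt_coe.1 (hr2'.trans_le (min_le_right _ _))).le⟩
      refine ⟨q, ⟨hqD, hqt⟩, hq1'.le, r, ⟨hrD, ENNReal.coe_lt_coe.1 (hq2'.trans_le hr1), hrt⟩, ?_⟩
      unfold stratifiedProcess
      rw [stratifiedPath_of_mem hq1'.le hq2', stratifiedPath_of_mem hr1 hr2]
      exact fun hc => hne (Option.some.inj hc).symm
    · rintro ⟨q, ⟨-, hqt⟩, hq, r, ⟨-, hqr, hrt⟩, hne⟩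
      by_contra hcon
      push Not at hcon
      refine hne ?_
      unfold stratifiedProcess
      have hr : (r : ℝ≥0∞) < epoch (fun i k => S i k ω) i (k + 1) :=
        (ENNReal.coe_le_coe.2 hrt).trans_lt hcon
      have hqr' : (q : ℝ≥0∞) < r := ENNReal.coe_lt_coe.2 hqr
      rw [stratifiedPath_of_mem hq (hqr'.trans hr), stratifiedPath_of_mem (hq.trans hqr'.le) hr]
  have hZ : ∀ s ≤ t, Measurable[𝓕 t, ⊤] (stratifiedProcess Y S s) := fun s hs =>
    measurable_iff_comap_le.2 (le_iSup₂_of_le s hs le_rfl)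
  rw [heq]
  refine MeasurableSet.biUnion (hDc.mono inter_subset_left) fun q hq => ?_
  refine (𝓕.mono hq.2.le _ (hk q)).inter ?_
  refine MeasurableSet.biUnion ((hDc.insert t).mono inter_subset_left) fun r hr => ?_
  refine MeasurableSet.compl ?_
  have hu : {ω | stratifiedProcess Y S q ω = stratifiedProcess Y S r ω} =
      ⋃ z : Option E, stratifiedProcess Y S q ⁻¹' {z} ∩ stratifiedProcess Y S r ⁻¹' {z} := by
    ext ω
    simp
    tauto
  rw [hu]
  exact MeasurableSet.iUnion fun z => (hZ q hq.2.le trivial).inter (hZ r hr.2.2 trivial)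

/-- The explosion times are stopping times for the filtration generated by the process. -/
theorem measurableSet_explosionTime_le (h : IsStratifiedJumpProcess L ν μ Y S) (i : ℕ) (t : ℝ≥0) :
    MeasurableSet[pathFiltration _ h.measurable_process t]
      {ω | explosionTime (fun i k => S i k ω) i ≤ t} := by
  induction i generalizing t with
  | zero => simp [explosionTime_zero]
  | succ i ih =>
    have hk : ∀ k, ∀ t : ℝ≥0, MeasurableSet[pathFiltration _ h.measurable_process t]
        {ω | epoch (fun i k => S i k ω) i k ≤ t} := by
      intro k
      induction k with
      | zero => simpa only [epoch_zero] using ih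
      | succ k hk => exact h.measurableSet_epoch_succ_le hk
    have : {ω | explosionTime (fun i k => S i k ω) (i + 1) ≤ t} =
        ⋂ k, {ω | epoch (fun i k => S i k ω) i k ≤ t} := by
      ext ω
      simp [← iSup_epoch]
    rw [this]
    exact MeasurableSet.iInter fun k => hk k t

theorem measurable_min_explosionTime (h : IsStratifiedJumpProcess L ν μ Y S) (i : ℕ) (t : ℝ≥0) :
    Measurable[pathFiltration _ h.measurable_process t]
      fun ω => min (t : ℝ≥0∞) (explosionTime (fun i k => S i k ω) i) := by
  exact measurable_min_of_measurableSet_le fun a ha =>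
    (pathFiltration _ h.measurable_process).mono ha.le _ (h.measurableSet_explosionTime_le i a)

end IsStratifiedJumpProcess

end Stopping

/-! ### The generator in terms of jump probabilities -/

namespace IsQMatrix

variable {E : Type*} {L : E → E → ℝ}

theorem hasSum_indicator (hL : IsQMatrix L) (x : E) :
    HasSum ({y | y ≠ x}.indicator (L x)) (exitRate L x) :=
  (hasSum_subtype_iff_indicator (f := L x) (s := {y | y ≠ x})).1 (hL.conservative x)

theorem indicator_nonneg (hL : IsQMatrix L) (x y : E) : 0 ≤ {y | y ≠ x}.indicator (L x) y :=
  Set.indicator_nonneg (fun y hy => hL.nonneg x y (Ne.symm hy)) y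

theorem exitRate_nonneg (hL : IsQMatrix L) (x : E) : 0 ≤ exitRate L x :=
  (hL.hasSum_indicator x).nonneg (hL.indicator_nonneg x)

theorem jumpProb_nonneg (hL : IsQMatrix L) (x y : E) : 0 ≤ jumpProb L x y := by
  unfold jumpProb
  split_ifs with h h1 h2
  · exact zero_le_one
  · exact le_rfl
  · exact le_rfl
  · exact div_nonneg (hL.nonneg x y h2) (hL.exitRate_nonneg x)

theorem hasSum_jumpProb (hL : IsQMatrix L) (x : E) : HasSum (jumpProb L x) 1 := by
  classical
  by_cases h : exitRate L x = 0
  · have h1 : jumpProb L x = fun y => if y = x then 1 else 0 := by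
      ext y
      unfold jumpProb
      rw [if_pos h]
      simp [eq_comm]
    rw [h1]
    exact hasSum_ite_eq x (1 : ℝ)
  · have := (hL.hasSum_indicator x).div_const (exitRate L x)
    rw [div_self h] at this
    have h1 : jumpProb L x = fun y => {y | y ≠ x}.indicator (L x) y / exitRate L x := by
      ext y
      unfold jumpProb
      rw [if_neg h]
      by_cases hy : x = y
      · simp [hy]
      · simp [hy, Ne.symm hy]
    rw [h1]
    exact this

theorem tsum_ofReal_jumpProb (hL : IsQMatrix L) (x : E) :
    ∑' y, ENNReal.ofReal (jumpProb L x y) = 1 := by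
  rw [← ENNReal.ofReal_tsum_of_nonneg (hL.jumpProb_nonneg x) (hL.hasSum_jumpProb x).summable,
    (hL.hasSum_jumpProb x).tsum_eq, ENNReal.ofReal_one]

theorem indicator_eq_mul_jumpProb (hL : IsQMatrix L) {x y : E} (hy : y ≠ x) :
    {y | y ≠ x}.indicator (L x) y = exitRate L x * jumpProb L x y := by
  by_cases h : exitRate L x = 0
  · have := hL.hasSum_indicator x
    rw [h, hasSum_zero_iff_of_nonneg (hL.indicator_nonneg x)] at this
    rw [h, zero_mul, this, Pi.zero_apply]
  · unfold jumpProb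
    rw [if_neg h, if_neg hy.symm, mul_div_cancel₀ _ h]
    simp [hy]

/-- The diagonal entry is minus the exit rate, and the off-diagonal entries sum to it, so `f x` can
be subtracted under the sum. At rate zero both sides vanish. -/
theorem genApply_eq (hL : IsQMatrix L) {f : E → ℝ} {K : ℝ} (hf : ∀ y, |f y| ≤ K) (x : E) :
    genApply L f x = exitRate L x * ∑' y, jumpProb L x y * (f y - f x) := by
  classical
  have h0 := hL.hasSum_indicator x
  have h1 : Summable fun y => {y | y ≠ x}.indicator (L x) y * f y := by
    refine Summable.of_norm_bounded (h0.summable.mul_right K) fun y => ?_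
    rw [norm_mul, Real.norm_eq_abs, Real.norm_eq_abs, abs_of_nonneg (hL.indicator_nonneg x y)]
    exact mul_le_mul_of_nonneg_left (hf y) (hL.indicator_nonneg x y)
  have h2 : HasSum (fun y => if y = x then exitRate L x * f x else 0) (exitRate L x * f x) :=
    hasSum_ite_eq x _
  have h3 : (fun y => L x y * f y) = fun y => {y | y ≠ x}.indicator (L x) y * f y -
      if y = x then exitRate L x * f x else 0 := by
    ext y
    by_cases hy : y = x
    · subst hy
      simp [exitRate]
    · simp [hy]
  rw [genApply, h3, h1.tsum_sub h2.summable, h2.tsum_eq, ← h0.tsum_eq, ← tsum_mul_right,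
    ← h1.tsum_sub (h0.summable.mul_right _), h0.tsum_eq, ← tsum_mul_left]
  refine tsum_congr fun y => ?_
  by_cases hy : y = x
  · simp [hy]
  · rw [hL.indicator_eq_mul_jumpProb hy]
    ring

end IsQMatrix

/-! ### Exponential laws on `[0, ∞]` -/

section ExponentialLaw

/-- The law `η` on `[0, ∞]` is exponential with parameter `q`, the case `q = 0` being the point
mass at infinity. -/
structure IsExpLaw (q : ℝ) (η : Measure ℝ≥0∞) : Prop where
  prob : IsProbabilityMeasure η
  tail : ∀ u : ℝ≥0, η (Ioi (u : ℝ≥0∞)) = ENNReal.ofReal (Real.exp (-(q * u)))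

theorem exists_isExpLaw {q : ℝ} (hq : 0 ≤ q) : ∃ η, IsExpLaw q η := by
  rcases hq.eq_or_lt with rfl | hq
  · refine ⟨Measure.dirac ⊤, inferInstance, fun u => ?_⟩
    rw [Measure.dirac_apply' _ measurableSet_Ioi]
    simp
  · have := isProbabilityMeasure_expMeasure hq
    refine ⟨(expMeasure q).map ENNReal.ofReal,
      Measure.isProbabilityMeasure_map ENNReal.measurable_ofReal.aemeasurable, fun u => ?_⟩
    rw [Measure.map_apply ENNReal.measurable_ofReal measurableSet_Ioi]
    have h1 : ENNReal.ofReal ⁻¹' Ioi (u : ℝ≥0∞) = (Iic (u : ℝ))ᶜ := by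
      ext v
      rw [mem_preimage, mem_Ioi, mem_compl_iff, mem_Iic, not_le, ← ENNReal.ofReal_coe_nnreal,
        ENNReal.ofReal_lt_ofReal_iff']
      exact and_iff_left_of_imp fun h => u.coe_nonneg.trans_lt h
    have h2 := cdf_expMeasure_eq hq u
    rw [if_pos u.coe_nonneg, cdf_eq_real] at h2
    rw [h1, ← ofReal_measureReal, probReal_compl_eq_one_sub measurableSet_Iic, h2, sub_sub_cancel]

theorem IsExpLaw.measureReal_Ioi {q : ℝ} {η : Measure ℝ≥0∞} (hη : IsExpLaw q η) (u : ℝ≥0) :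
    η.real (Ioi (u : ℝ≥0∞)) = Real.exp (-(q * u)) := by
  rw [measureReal_def, hη.tail, ENNReal.toReal_ofReal (Real.exp_nonneg _)]

/-- By the layer-cake formula the integral is that of the tail $e^{-qv}$ over $(0,b)$. The factor
`q` stays on the left so that `q = 0` needs no separate treatment. -/
theorem IsExpLaw.mul_integral_min {q : ℝ} {η : Measure ℝ≥0∞} (hη : IsExpLaw q η) (b : ℝ≥0) :
    q * ∫ u, (min (b : ℝ≥0∞) u).toReal ∂η = 1 - Real.exp (-(q * b)) := by
  have := hη.prob
  have hm : Measurable fun u : ℝ≥0∞ => (min (b : ℝ≥0∞) u).toReal :=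
    (measurable_const.min measurable_id).ennreal_toReal
  have hint : Integrable (fun u : ℝ≥0∞ => (min (b : ℝ≥0∞) u).toReal) η := by
    refine Integrable.of_bound hm.aestronglyMeasurable (b : ℝ) (Eventually.of_forall fun u => ?_)
    rw [Real.norm_eq_abs, abs_of_nonneg ENNReal.toReal_nonneg]
    exact ENNReal.toReal_mono ENNReal.coe_ne_top (min_le_left _ _)
  rw [hint.integral_eq_integral_meas_lt (Eventually.of_forall fun _ => ENNReal.toReal_nonneg)]
  have h1 : ∀ v ∈ Ioi (0 : ℝ), η.real {u | v < (min (b : ℝ≥0∞) u).toReal} =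
      (Iio (b : ℝ)).indicator (fun v => Real.exp (-(q * v))) v := by
    intro v hv
    have hmin : ∀ u, min (b : ℝ≥0∞) u ≠ ⊤ := fun u =>
      ne_top_of_le_ne_top ENNReal.coe_ne_top (min_le_left _ _)
    have hset : {u | v < (min (b : ℝ≥0∞) u).toReal} =
        {u | v < b ∧ ((v.toNNReal : ℝ≥0) : ℝ≥0∞) < u} := by
      ext u
      have : ENNReal.ofReal v < b ↔ v < b := by
        rw [← ENNReal.ofReal_coe_nnreal, ENNReal.ofReal_lt_ofReal_iff']
        exact and_iff_left_of_imp fun h => (mem_Ioi.1 hv).trans h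
      rw [mem_ofPred_eq, mem_ofPred_eq, ← ENNReal.ofReal_lt_iff_lt_toReal (le_of_lt hv) (hmin u),
        lt_min_iff, this]
      rfl
    rw [hset]
    by_cases hvb : v < b
    · rw [indicator_of_mem (by exact hvb)]
      simp only [hvb, true_and]
      exact (hη.measureReal_Ioi v.toNNReal).trans (by rw [Real.coe_toNNReal _ (le_of_lt hv)])
    · rw [indicator_of_notMem (by exact hvb)]
      simp [hvb]
  rw [setIntegral_congr_fun measurableSet_Ioi h1, setIntegral_indicator measurableSet_Iio,
    Ioi_inter_Iio, ← integral_Ioc_eq_integral_Ioo, ← intervalIntegral.integral_of_le b.coe_nonneg,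
    ← intervalIntegral.integral_const_mul]
  have hder : ∀ v ∈ uIcc (0 : ℝ) b,
      HasDerivAt (fun v => -Real.exp (-(q * v))) (q * Real.exp (-(q * v))) v := by
    intro v _
    have := (((hasDerivAt_id v).const_mul q).neg).exp.neg
    exact this.congr_deriv (by simp; ring)
  rw [intervalIntegral.integral_eq_sub_of_hasDerivAt hder
    (Continuous.intervalIntegrable (by fun_prop) _ _)]
  simp
  ring

/-- The compensator identity behind the martingale property: the probability of a jump by time `t`
is the rate times the mean time spent waiting before `t`. -/
theorem IsExpLaw.measureReal_add_le {q : ℝ} {η : Measure ℝ≥0∞} (hη : IsExpLaw q η) (t : ℝ≥0)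
    (r : ℝ≥0∞) : η.real {u | r + u ≤ t} =
      q * ∫ u, ((min (t : ℝ≥0∞) (r + u)).toReal - (min (t : ℝ≥0∞) r).toReal) ∂η := by
  have := hη.prob
  rcases lt_or_ge (t : ℝ≥0∞) r with h | h
  · have h1 : {u | r + u ≤ t} = ∅ := by
      ext u
      simp [h.trans_le le_self_add]
    have h2 : ∀ u, min (t : ℝ≥0∞) (r + u) = t := fun u => min_eq_left (h.le.trans le_self_add)
    simp [h1, h2, min_eq_left h.le]
  · lift r to ℝ≥0 using ne_top_of_le_ne_top ENNReal.coe_ne_top h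
    obtain ⟨b, rfl⟩ := exists_add_of_le (ENNReal.coe_le_coe.1 h)
    have h1 : {u : ℝ≥0∞ | r + u ≤ (r + b : ℝ≥0)} = (Ioi (b : ℝ≥0∞))ᶜ := by
      ext u
      simp only [mem_ofPred_eq, ENNReal.coe_add, compl_Ioi, mem_Iic]
      exact ENNReal.add_le_add_iff_left ENNReal.coe_ne_top
    have h2 : ∀ u : ℝ≥0∞, (min ((r + b : ℝ≥0) : ℝ≥0∞) (r + u)).toReal -
        (min ((r + b : ℝ≥0) : ℝ≥0∞) r).toReal = (min (b : ℝ≥0∞) u).toReal := by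
      intro u
      rw [min_eq_right h, ENNReal.coe_add, min_add_add_left, ENNReal.toReal_add ENNReal.coe_ne_top
        (ne_top_of_le_ne_top ENNReal.coe_ne_top (min_le_left _ _))]
      simp
    simp_rw [h2]
    rw [hη.mul_integral_min, h1, probReal_compl_eq_one_sub measurableSet_Ioi, hη.measureReal_Ioi]

end ExponentialLaw

/-! ### Law of the next holding time and state given the past -/

theorem measure_eq_tsum_inter_fiber {Ω E : Type*} [MeasurableSpace Ω] [Countable E]
    [MeasurableSpace E] [MeasurableSingletonClass E] {g : Ω → E} (hg : Measurable g)
    (μ : Measure Ω) {B : Set Ω} (hB : MeasurableSet B) :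
    μ B = ∑' y, μ (B ∩ {ω | g ω = y}) := by
  change μ B = ∑' y, μ (B ∩ g ⁻¹' {y})
  rw [← measure_iUnion _ fun y => hB.inter (hg (measurableSet_singleton y)), ← inter_iUnion]
  · congr 1
    ext ω
    simp
  · intro y z hyz
    refine disjoint_left.2 fun ω h1 h2 => hyz ?_
    exact h1.2.symm.trans h2.2

theorem measurable_of_measurableSet_Ioi {Ω : Type*} {m : MeasurableSpace Ω} {g : Ω → ℝ≥0∞}
    (h : ∀ a, MeasurableSet (g ⁻¹' Ioi a)) : Measurable g :=
  measurable_of_Ioi h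

/-- The event that the `i`-th explosion time is finite, that the `i`-th piece visits the states
`x 0, …, x k` successively, and that its first holding times are positive. -/
def pieceEvent {E Ω : Type*} (Y : ℕ → ℕ → Ω → E) (S : ℕ → ℕ → Ω → ℝ≥0∞) (i k : ℕ) (x : ℕ → E) :
    Set Ω :=
  {ω | explosionTime (fun i k => S i k ω) i < ⊤ ∧ ∀ j ≤ k, Y i j ω = x j ∧ 0 < S i j ω}

/-- The information contained in the pieces with index less than `i` and in the first `k` holding
times of the `i`-th piece. -/
abbrev pastHoldings {E Ω : Type*} [MeasurableSpace E] (Y : ℕ → ℕ → Ω → E)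
    (S : ℕ → ℕ → Ω → ℝ≥0∞) (i k : ℕ) : MeasurableSpace Ω :=
  past Y S i ⊔ ⨆ j < k, MeasurableSpace.comap (S i j) inferInstance

section Past

variable {E Ω : Type*} [MeasurableSpace E] (Y : ℕ → ℕ → Ω → E) (S : ℕ → ℕ → Ω → ℝ≥0∞)

theorem measurable_holding_past {i j : ℕ} (hj : j < i) (k : ℕ) :
    Measurable[past Y S i] (S j k) :=
  measurable_iff_comap_le.2 (le_iSup₂_of_le j hj (le_iSup_of_le k le_sup_right))

theorem measurable_state_past {i j : ℕ} (hj : j < i) (k : ℕ) :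
    Measurable[past Y S i] (Y j k) :=
  measurable_iff_comap_le.2 (le_iSup₂_of_le j hj (le_iSup_of_le k le_sup_left))

theorem measurable_explosionTime_past (i : ℕ) :
    Measurable[past Y S i] fun ω => explosionTime (fun i k => S i k ω) i := by
  refine Finset.measurable_sum _ fun j hj => Measurable.iSup fun k =>
    Finset.measurable_sum _ fun l _ => ?_
  exact measurable_holding_past Y S (Finset.mem_range.1 hj) l

theorem measurable_epoch_past {i j : ℕ} (hj : j < i) (k : ℕ) :
    Measurable[past Y S i] fun ω => epoch (fun i k => S i k ω) j k := by
  refine Measurable.add (Finset.measurable_sum _ fun l hl => Measurable.iSup fun k =>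
    Finset.measurable_sum _ fun m _ => ?_) (Finset.measurable_sum _ fun m _ => ?_)
  · exact measurable_holding_past Y S ((Finset.mem_range.1 hl).trans hj) m
  · exact measurable_holding_past Y S hj m

theorem measurable_epoch_pastHoldings {i k l : ℕ} (hl : l ≤ k) :
    Measurable[pastHoldings Y S i k] fun ω => epoch (fun i k => S i k ω) i l := by
  refine Measurable.add ?_ (Finset.measurable_sum _ fun m hm => ?_)
  · exact (measurable_explosionTime_past Y S i).mono le_sup_left le_rfl
  · exact measurable_iff_comap_le.2
      (le_sup_of_le_right (le_iSup₂_of_le m ((Finset.mem_range.1 hm).trans_le hl) le_rfl))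

/-- A `π`-system that generates `pastHoldings Y S i k`. -/
def holdingSets (i k : ℕ) : Set (Set Ω) :=
  {C | ∃ A, MeasurableSet[past Y S i] A ∧ ∃ s : ℕ → WithBot ℝ≥0∞,
    C = A ∩ {ω | ∀ j < k, s j < (S i j ω : WithBot ℝ≥0∞)}}

theorem isPiSystem_holdingSets (i k : ℕ) : IsPiSystem (holdingSets Y S i k) := by
  rintro _ ⟨A, hA, s, rfl⟩ _ ⟨B, hB, s', rfl⟩ -
  refine ⟨A ∩ B, hA.inter hB, fun j => s j ⊔ s' j, ?_⟩
  ext ω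
  simp only [mem_inter_iff, mem_ofPred_eq, sup_lt_iff]
  grind

/-- The threshold `⊥` imposes no condition, so events of the past and conditions on a single holding
time both belong to the system. -/
theorem generateFrom_holdingSets (i k : ℕ) :
    pastHoldings Y S i k = MeasurableSpace.generateFrom (holdingSets Y S i k) := by
  refine le_antisymm (sup_le ?_ (iSup₂_le fun j hj => ?_)) (MeasurableSpace.generateFrom_le ?_)
  · intro A hA
    exact MeasurableSpace.measurableSet_generateFrom ⟨A, hA, fun _ => ⊥, by simp⟩
  · rw [← measurable_iff_comap_le]
    refine measurable_of_measurableSet_Ioi fun a => ?_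
    refine MeasurableSpace.measurableSet_generateFrom ⟨univ, MeasurableSet.univ,
      fun l => if l = j then a else ⊥, ?_⟩
    ext ω
    simp only [mem_preimage, mem_Ioi, univ_inter, mem_ofPred_eq]
    constructor
    · intro h l _
      split_ifs with hl
      · subst hl
        exact WithBot.coe_lt_coe.2 h
      · exact WithBot.bot_lt_coe _
    · intro h
      simpa using h j hj
  · rintro _ ⟨A, hA, s, rfl⟩
    refine MeasurableSet.inter ((le_sup_left : past Y S i ≤ pastHoldings Y S i k) _ hA) ?_
    have : {ω | ∀ j < k, s j < (S i j ω : WithBot ℝ≥0∞)} =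
        ⋂ j, ⋂ (_ : j < k), {ω | s j < (S i j ω : WithBot ℝ≥0∞)} := by
      ext ω
      simp
    rw [this]
    refine MeasurableSet.iInter fun j => MeasurableSet.iInter fun hj => ?_
    have hm : Measurable[pastHoldings Y S i k] (S i j) :=
      measurable_iff_comap_le.2 (le_sup_of_le_right (le_iSup₂_of_le j hj le_rfl))
    induction s j using WithBot.recBotCoe with
    | bot => simp
    | coe a =>
      simp only [WithBot.coe_lt_coe]
      exact hm measurableSet_Ioi

end Past

namespace IsStratifiedJumpProcess

variable {E Ω : Type*} [TopologicalSpace E] [MeasurableSpace E] [MeasurableSpace Ω]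
  {L : E → E → ℝ} {ν : Measure E} {μ : Measure Ω}
  {Y : ℕ → ℕ → Ω → E} {S : ℕ → ℕ → Ω → ℝ≥0∞}

theorem past_le (h : IsStratifiedJumpProcess L ν μ Y S) (i : ℕ) : past Y S i ≤ ‹_› :=
  iSup₂_le fun j _ => iSup_le fun k =>
    sup_le (h.measurable_state j k).comap_le (h.measurable_holding j k).comap_le

theorem pastHoldings_le (h : IsStratifiedJumpProcess L ν μ Y S) (i k : ℕ) :
    pastHoldings Y S i k ≤ ‹_› :=
  sup_le (h.past_le i) (iSup₂_le fun j _ => (h.measurable_holding i j).comap_le)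

variable [MeasurableSingletonClass E]

theorem measurableSet_pieceEvent (h : IsStratifiedJumpProcess L ν μ Y S) (i k : ℕ) (x : ℕ → E) :
    MeasurableSet (pieceEvent Y S i k x) := by
  have : pieceEvent Y S i k x = {ω | explosionTime (fun i k => S i k ω) i < ⊤} ∩
      ⋂ j, ⋂ (_ : j ≤ k), (Y i j ⁻¹' {x j} ∩ S i j ⁻¹' Ioi 0) := by
    ext ω
    simp [pieceEvent]
  rw [this]
  refine (h.past_le i _ (measurable_explosionTime_past Y S i measurableSet_Iio)).inter
    (MeasurableSet.iInter fun j => MeasurableSet.iInter fun _ => ?_)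
  exact (h.measurable_state i j (measurableSet_singleton _)).inter
    (h.measurable_holding i j measurableSet_Ioi)

/-- The law of a restarted piece with the conditioning multiplied out, which also makes it valid for
null events. -/
theorem restart_law [IsProbabilityMeasure μ] (h : IsStratifiedJumpProcess L ν μ Y S) {i : ℕ}
    {A : Set Ω} (hA : MeasurableSet[past Y S i] A) (n : ℕ) (x : ℕ → E) (s : ℕ → ℝ≥0) :
    μ (A ∩ {ω | explosionTime (fun i k => S i k ω) i < ⊤ ∧ (∀ k ≤ n, Y i k ω = x k) ∧
        ∀ k < n, (s k : ℝ≥0∞) < S i k ω}) =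
      μ (A ∩ {ω | explosionTime (fun i k => S i k ω) i < ⊤ ∧ Y i 0 ω = x 0}) *
        ENNReal.ofReal (∏ k ∈ Finset.range n,
          (jumpProb L (x k) (x (k + 1)) * Real.exp (-(exitRate L (x k) * s k)))) := by
  set B := A ∩ {ω | explosionTime (fun i k => S i k ω) i < ⊤ ∧ Y i 0 ω = x 0} with hBdef
  have hset : A ∩ {ω | explosionTime (fun i k => S i k ω) i < ⊤ ∧ (∀ k ≤ n, Y i k ω = x k) ∧
        ∀ k < n, (s k : ℝ≥0∞) < S i k ω} =
      B ∩ {ω | (∀ k ≤ n, Y i k ω = x k) ∧ ∀ k < n, (s k : ℝ≥0∞) < S i k ω} := by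
    ext ω
    simp only [hBdef, mem_inter_iff, mem_ofPred_eq]
    constructor
    · rintro ⟨h1, h2, h3, h4⟩
      exact ⟨⟨h1, h2, h3 0 n.zero_le⟩, h3, h4⟩
    · rintro ⟨⟨h1, h2, -⟩, h3, h4⟩
      exact ⟨h1, h2, h3, h4⟩
  have hB : MeasurableSet B := (h.past_le i _ hA).inter
    ((h.past_le i _ (measurable_explosionTime_past Y S i measurableSet_Iio)).inter
      (h.measurable_state i 0 (measurableSet_singleton _)))
  rw [hset]
  by_cases h0 : μ B = 0
  · rw [h0, zero_mul]
    exact measure_mono_null inter_subset_left h0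
  · have := (h.restart i (x 0) A hA h0).law n x s
    rw [cond_apply hB, Measure.dirac_apply' _ (measurableSet_singleton _)] at this
    simp only [mem_singleton_iff, indicator_of_mem, Pi.one_apply, one_mul] at this
    rw [← this, ← mul_assoc, ENNReal.mul_inv_cancel h0 (measure_ne_top _ _), one_mul]

/-- This is `restart_law` for `k + 1` steps with the last state `y` and the last threshold `u` split
off. The positivity required by `pieceEvent` is implied by the lower bounds on the holding times. -/
theorem measure_step [IsProbabilityMeasure μ] (h : IsStratifiedJumpProcess L ν μ Y S)
    (hL : IsQMatrix L) {i : ℕ} {A : Set Ω} (hA : MeasurableSet[past Y S i] A) (k : ℕ) (x : ℕ → E)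
    (s : ℕ → ℝ≥0) (y : E) (u : ℝ≥0) :
    μ (A ∩ {ω | ∀ j < k, (s j : ℝ≥0∞) < S i j ω} ∩ pieceEvent Y S i k x ∩
        {ω | (u : ℝ≥0∞) < S i k ω} ∩ {ω | Y i (k + 1) ω = y}) =
      μ (A ∩ {ω | explosionTime (fun i k => S i k ω) i < ⊤ ∧ Y i 0 ω = x 0}) *
        ENNReal.ofReal (∏ j ∈ Finset.range k,
          (jumpProb L (x j) (x (j + 1)) * Real.exp (-(exitRate L (x j) * s j)))) *
        ENNReal.ofReal (jumpProb L (x k) y) *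
        ENNReal.ofReal (Real.exp (-(exitRate L (x k) * u))) := by
  have key := h.restart_law hA (k + 1) (fun j => if j ≤ k then x j else y)
    (fun j => if j < k then s j else u)
  have hprod : ∏ j ∈ Finset.range k, (jumpProb L (if j ≤ k then x j else y)
      (if j + 1 ≤ k then x (j + 1) else y) * Real.exp (-(exitRate L (if j ≤ k then x j else y) *
        ((if j < k then s j else u : ℝ≥0) : ℝ)))) = ∏ j ∈ Finset.range k,
          (jumpProb L (x j) (x (j + 1)) * Real.exp (-(exitRate L (x j) * s j))) := by
    refine Finset.prod_congr rfl fun j hj => ?_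
    have hj := Finset.mem_range.1 hj
    rw [if_pos hj.le, if_pos (by omega), if_pos hj]
  have hpos : 0 ≤ ∏ j ∈ Finset.range k,
      (jumpProb L (x j) (x (j + 1)) * Real.exp (-(exitRate L (x j) * s j))) :=
    Finset.prod_nonneg fun j _ => mul_nonneg (hL.jumpProb_nonneg _ _) (Real.exp_nonneg _)
  rw [Finset.prod_range_succ, hprod, ENNReal.ofReal_mul hpos, if_neg k.lt_succ_self.not_ge,
    if_neg k.lt_irrefl, if_pos le_rfl, ENNReal.ofReal_mul (hL.jumpProb_nonneg _ _)] at key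
  rw [if_pos k.zero_le] at key
  rw [mul_assoc, mul_assoc, ← key]
  congr 1
  ext ω
  simp only [mem_inter_iff, mem_ofPred_eq, pieceEvent]
  constructor
  · rintro ⟨⟨⟨⟨h1, h2⟩, h3, h4⟩, h5⟩, h6⟩
    refine ⟨h1, h3, fun j hj => ?_, fun j hj => ?_⟩
    · split_ifs with hjk
      · exact (h4 j hjk).1
      · obtain rfl : j = k + 1 := by omega
        exact h6
    · split_ifs with hjk
      · exact h2 j hjk
      · obtain rfl : j = k := by omega
        exact h5
  · rintro ⟨h1, h2, h3, h4⟩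
    have hk : (u : ℝ≥0∞) < S i k ω := by simpa using h4 k (by omega)
    have hj : ∀ j < k, (s j : ℝ≥0∞) < S i j ω := fun j hj => by
      simpa [hj] using h4 j (by omega)
    refine ⟨⟨⟨⟨h1, hj⟩, h2, fun j hjk => ⟨?_, ?_⟩⟩, hk⟩, ?_⟩
    · simpa [hjk] using h3 j (by omega)
    · rcases hjk.lt_or_eq with hlt | rfl
      · exact (zero_le).trans_lt (hj j hlt)
      · exact (zero_le).trans_lt hk
    · simpa using h3 (k + 1) le_rfl

end IsStratifiedJumpProcess

namespace IsStratifiedJumpProcess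

variable {E Ω : Type*} [TopologicalSpace E] [MeasurableSpace E] [MeasurableSpace Ω]
  [MeasurableSingletonClass E] [Countable E] {L : E → E → ℝ} {ν : Measure E} {μ : Measure Ω}
  [IsProbabilityMeasure μ] {Y : ℕ → ℕ → Ω → E} {S : ℕ → ℕ → Ω → ℝ≥0∞}

theorem measure_inter_tail_of_mem_holdingSets (h : IsStratifiedJumpProcess L ν μ Y S)
    (hL : IsQMatrix L) {i k : ℕ} {C : Set Ω} (hC : C ∈ holdingSets Y S i k) (x : ℕ → E) (y : E)
    (u : ℝ≥0) :
    μ (C ∩ pieceEvent Y S i k x ∩ {ω | (u : ℝ≥0∞) < S i k ω} ∩ {ω | Y i (k + 1) ω = y}) =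
      μ (C ∩ pieceEvent Y S i k x) * ENNReal.ofReal (jumpProb L (x k) y) *
        ENNReal.ofReal (Real.exp (-(exitRate L (x k) * u))) := by
  obtain ⟨A, hA, s, rfl⟩ := hC
  by_cases htop : ∃ j < k, s j = ⊤
  · obtain ⟨j, hj, hs⟩ := htop
    have : {ω | ∀ j < k, s j < (S i j ω : WithBot ℝ≥0∞)} = ∅ := by
      refine eq_empty_of_forall_notMem fun ω hω => ?_
      have := hω j hj
      rw [hs] at this
      exact not_top_lt this
    simp [this]
  push Not at htop
  -- On a piece event the holding times are positive, so the threshold `⊥` may be replaced by `0`,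
  -- to which the law of a minimal process applies.
  have hset : A ∩ {ω | ∀ j < k, s j < (S i j ω : WithBot ℝ≥0∞)} ∩ pieceEvent Y S i k x =
      A ∩ {ω | ∀ j < k, (((s j).unbotD 0).toNNReal : ℝ≥0∞) < S i j ω} ∩ pieceEvent Y S i k x := by
    ext ω
    simp only [mem_inter_iff, mem_ofPred_eq, and_assoc, and_congr_right_iff]
    intro _
    refine and_congr_left fun hp => forall₂_congr fun j hj => ?_
    have hsj := htop j hj
    have hpos := (hp.2 j hj.le).2
    generalize s j = a at hsj
    induction a using WithBot.recBotCoe with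
    | bot => simpa using hpos
    | coe a =>
      have ha : a ≠ ⊤ := fun h => hsj (by rw [h]; rfl)
      rw [WithBot.unbotD_coe, ENNReal.coe_toNNReal ha, WithBot.coe_lt_coe]
  rw [hset]
  set B := A ∩ {ω | ∀ j < k, (((s j).unbotD 0).toNNReal : ℝ≥0∞) < S i j ω} ∩
    pieceEvent Y S i k x with hB
  have hBm : MeasurableSet B := by
    rw [← hset]
    refine MeasurableSet.inter (h.pastHoldings_le i k _ ?_) (h.measurableSet_pieceEvent i k x)
    rw [generateFrom_holdingSets]
    exact MeasurableSpace.measurableSet_generateFrom ⟨A, hA, s, rfl⟩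
  have hstep := h.measure_step hL hA k x (fun j => ((s j).unbotD 0).toNNReal)
  rw [← hB] at hstep
  have hBc : μ B = μ (A ∩ {ω | explosionTime (fun i k => S i k ω) i < ⊤ ∧ Y i 0 ω = x 0}) *
      ENNReal.ofReal (∏ j ∈ Finset.range k, (jumpProb L (x j) (x (j + 1)) *
        Real.exp (-(exitRate L (x j) * ((s j).unbotD 0).toNNReal)))) := by
    -- Taking `u = 0` in `hstep` and summing over the next state gives the mass of `B` itself.
    have h0 : B = B ∩ {ω | ((0 : ℝ≥0) : ℝ≥0∞) < S i k ω} := by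
      refine (inter_eq_left.2 fun ω hω => ?_).symm
      exact (hω.2.2 k le_rfl).2
    have hm : MeasurableSet (B ∩ {ω | ((0 : ℝ≥0) : ℝ≥0∞) < S i k ω}) :=
      hBm.inter (h.measurable_holding i k measurableSet_Ioi)
    rw [h0, measure_eq_tsum_inter_fiber (h.measurable_state i (k + 1)) μ hm]
    simp_rw [hstep]
    simp [ENNReal.tsum_mul_left, hL.tsum_ofReal_jumpProb]
  rw [hstep, hBc]

theorem measure_inter_tail (h : IsStratifiedJumpProcess L ν μ Y S)
    (hL : IsQMatrix L) {i k : ℕ} {C : Set Ω} (hC : MeasurableSet[pastHoldings Y S i k] C)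
    (x : ℕ → E) (y : E) (u : ℝ≥0) :
    μ (C ∩ pieceEvent Y S i k x ∩ {ω | (u : ℝ≥0∞) < S i k ω} ∩ {ω | Y i (k + 1) ω = y}) =
      μ (C ∩ pieceEvent Y S i k x) * ENNReal.ofReal (jumpProb L (x k) y) *
        ENNReal.ofReal (Real.exp (-(exitRate L (x k) * u))) := by
  have hle := h.pastHoldings_le i k
  have hF := h.measurableSet_pieceEvent i k x
  set c := ENNReal.ofReal (jumpProb L (x k) y) *
        ENNReal.ofReal (Real.exp (-(exitRate L (x k) * u)))
  -- For fixed `x`, `y` and `u`, both sides are finite measures in `C`; they agree on the generating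
  -- `π`-system, which contains the whole space.
  have key : (μ.restrict (pieceEvent Y S i k x ∩ {ω | (u : ℝ≥0∞) < S i k ω} ∩
      {ω | Y i (k + 1) ω = y})).trim hle = (c • μ.restrict (pieceEvent Y S i k x)).trim hle := by
    have happ : ∀ C ∈ holdingSets Y S i k, (μ.restrict (pieceEvent Y S i k x ∩
        {ω | (u : ℝ≥0∞) < S i k ω} ∩ {ω | Y i (k + 1) ω = y})).trim hle C =
        (c • μ.restrict (pieceEvent Y S i k x)).trim hle C := by
      intro C hC
      have hCm : MeasurableSet[pastHoldings Y S i k] C := by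
        rw [generateFrom_holdingSets]
        exact MeasurableSpace.measurableSet_generateFrom hC
      rw [trim_measurableSet_eq hle hCm, trim_measurableSet_eq hle hCm, Measure.smul_apply,
        Measure.restrict_apply (hle _ hCm), Measure.restrict_apply (hle _ hCm), ← inter_assoc,
        ← inter_assoc, h.measure_inter_tail_of_mem_holdingSets hL hC, mul_assoc, mul_comm]
      rfl
    refine ext_of_generate_finite _ (generateFrom_holdingSets Y S i k)
      (isPiSystem_holdingSets Y S i k) happ (happ univ ?_)
    exact ⟨univ, MeasurableSet.univ, fun _ => ⊥, by simp⟩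
  have := DFunLike.congr_fun key C
  rw [trim_measurableSet_eq hle hC, trim_measurableSet_eq hle hC, Measure.smul_apply,
    Measure.restrict_apply (hle _ hC), Measure.restrict_apply (hle _ hC), ← inter_assoc,
    ← inter_assoc] at this
  rw [this, mul_assoc, mul_comm]
  rfl

/-- Given the past, the holding time in a state is exponential, and independent of it the next
state is chosen according to `jumpProb`. -/
theorem measure_inter_preimage (h : IsStratifiedJumpProcess L ν μ Y S)
    (hL : IsQMatrix L) {i k : ℕ} {C : Set Ω} (hC : MeasurableSet[pastHoldings Y S i k] C)
    (x : ℕ → E) (y : E) {η : Measure ℝ≥0∞} (hη : IsExpLaw (exitRate L (x k)) η)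
    {B : Set ℝ≥0∞} (hB : MeasurableSet B) :
    μ (C ∩ pieceEvent Y S i k x ∩ {ω | Y i (k + 1) ω = y} ∩ S i k ⁻¹' B) =
      μ (C ∩ pieceEvent Y S i k x) * ENNReal.ofReal (jumpProb L (x k) y) * η B := by
  have := hη.prob
  set D := C ∩ pieceEvent Y S i k x
  set c := μ D * ENNReal.ofReal (jumpProb L (x k) y)
  have hc : c ≠ ⊤ := ENNReal.mul_ne_top (measure_ne_top _ _) ENNReal.ofReal_ne_top
  have hcf : IsFiniteMeasure (c • η) := Measure.smul_finite η hc
  have htail : ∀ u : ℝ≥0, μ (D ∩ {ω | Y i (k + 1) ω = y} ∩ S i k ⁻¹' Ioi (u : ℝ≥0∞)) =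
      c * η (Ioi (u : ℝ≥0∞)) := by
    intro u
    rw [hη.tail, ← h.measure_inter_tail hL hC x y u, inter_right_comm]
    rfl
  have hone : η (Ioi ((0 : ℝ≥0) : ℝ≥0∞)) = 1 := by
    rw [hη.tail]
    simp
  -- Positivity of the current holding time is part of the piece event, so the total mass is the
  -- tail at zero.
  have hD : D ∩ {ω | Y i (k + 1) ω = y} =
      D ∩ {ω | Y i (k + 1) ω = y} ∩ S i k ⁻¹' Ioi ((0 : ℝ≥0) : ℝ≥0∞) :=
    (inter_eq_left.2 fun ω hω => (hω.1.2.2 k le_rfl).2).symm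
  have htot : μ (D ∩ {ω | Y i (k + 1) ω = y}) = c := by
    rw [hD, htail, hone, mul_one]
  have key : (μ.restrict (D ∩ {ω | Y i (k + 1) ω = y})).map (S i k) = c • η := by
    refine Measure.ext_of_Iic _ _ fun a => ?_
    have h1 : ∀ m : Measure ℝ≥0∞, IsFiniteMeasure m → m (Iic a) = m univ - m (Ioi a) := by
      intro m _
      rw [← compl_Ioi, measure_compl measurableSet_Ioi (measure_ne_top _ _)]
    rw [h1 _ inferInstance, h1 _ hcf]
    have h2 : (μ.restrict (D ∩ {ω | Y i (k + 1) ω = y})).map (S i k) univ = (c • η) univ := by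
      rw [Measure.map_apply (h.measurable_holding i k) MeasurableSet.univ, preimage_univ,
        Measure.restrict_apply_univ, htot, Measure.smul_apply, measure_univ]
      simp
    have h3 : (μ.restrict (D ∩ {ω | Y i (k + 1) ω = y})).map (S i k) (Ioi a) =
        (c • η) (Ioi a) := by
      induction a using ENNReal.recTopCoe with
      | top => simp
      | coe u =>
        rw [Measure.map_apply (h.measurable_holding i k) measurableSet_Ioi, Measure.restrict_apply
          (h.measurable_holding i k measurableSet_Ioi), inter_comm, htail]
        rfl
    rw [h2, h3]
  have := DFunLike.congr_fun key B
  rw [Measure.map_apply (h.measurable_holding i k) hB,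
    Measure.restrict_apply (h.measurable_holding i k hB), inter_comm] at this
  exact this

/-- The `k`-th epoch depends only on the past and the earlier holding times, so it can be absorbed
into the conditioning event. This gives the product law needed for Fubini. -/
theorem map_epoch_holding (h : IsStratifiedJumpProcess L ν μ Y S)
    (hL : IsQMatrix L) {i k : ℕ} {C : Set Ω} (hC : MeasurableSet[pastHoldings Y S i k] C)
    (x : ℕ → E) (y : E) {η : Measure ℝ≥0∞} (hη : IsExpLaw (exitRate L (x k)) η) :
    (μ.restrict (C ∩ pieceEvent Y S i k x ∩ {ω | Y i (k + 1) ω = y})).map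
        (fun ω => (epoch (fun i k => S i k ω) i k, S i k ω)) =
      ENNReal.ofReal (jumpProb L (x k) y) • ((μ.restrict (C ∩ pieceEvent Y S i k x)).map
        (fun ω => epoch (fun i k => S i k ω) i k)).prod η := by
  have := hη.prob
  have hR := h.measurable_epoch i k
  have hU := h.measurable_holding i k
  have hR' : Measurable[pastHoldings Y S i k] fun ω => epoch (fun i k => S i k ω) i k :=
    measurable_epoch_pastHoldings Y S le_rfl
  have hfin : IsFiniteMeasure (ENNReal.ofReal (jumpProb L (x k) y) •
      (μ.restrict (C ∩ pieceEvent Y S i k x)).map (fun ω => epoch (fun i k => S i k ω) i k)) :=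
    Measure.smul_finite _ ENNReal.ofReal_ne_top
  rw [← Measure.prod_smul_left]
  symm
  refine Measure.prod_eq fun s B hs hB => ?_
  rw [Measure.map_apply (hR.prodMk hU) (hs.prod hB),
    Measure.restrict_apply ((hR.prodMk hU) (hs.prod hB)), Measure.smul_apply,
    Measure.map_apply hR hs, Measure.restrict_apply (hR hs), smul_eq_mul]
  have := h.measure_inter_preimage hL ((hR' hs).inter hC) x y hη hB
  rw [inter_assoc _ C] at this
  rw [mul_comm (ENNReal.ofReal _), ← this]
  congr 1
  ext ω
  simp only [mem_inter_iff, mem_preimage, mem_prod, mem_ofPred_eq]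
  tauto

end IsStratifiedJumpProcess

/-! ### One increment of the Dynkin process -/

theorem abs_min_toReal_sub_le (t : ℝ≥0) (a b : ℝ≥0∞) :
    |(min (t : ℝ≥0∞) a).toReal - (min (t : ℝ≥0∞) b).toReal| ≤ t := by
  have key : ∀ a, (min (t : ℝ≥0∞) a).toReal ≤ t := fun a =>
    ENNReal.toReal_mono ENNReal.coe_ne_top (min_le_left _ _)
  have h1 := key a
  have h2 := key b
  have h3 : 0 ≤ (min (t : ℝ≥0∞) a).toReal := ENNReal.toReal_nonneg
  have h4 : 0 ≤ (min (t : ℝ≥0∞) b).toReal := ENNReal.toReal_nonneg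
  rw [abs_le]
  constructor <;> linarith

namespace IsStratifiedJumpProcess

variable {E Ω : Type*} [TopologicalSpace E] [MeasurableSpace E] [MeasurableSpace Ω]
  [MeasurableSingletonClass E] [Countable E] {L : E → E → ℝ} {ν : Measure E} {μ : Measure Ω}
  [IsProbabilityMeasure μ] {Y : ℕ → ℕ → Ω → E} {S : ℕ → ℕ → Ω → ℝ≥0∞}

theorem map_epoch_holding' (h : IsStratifiedJumpProcess L ν μ Y S)
    (hL : IsQMatrix L) {i k : ℕ} {C : Set Ω} (hC : MeasurableSet[pastHoldings Y S i k] C)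
    (x : ℕ → E) {η : Measure ℝ≥0∞} (hη : IsExpLaw (exitRate L (x k)) η) :
    (μ.restrict (C ∩ pieceEvent Y S i k x)).map
        (fun ω => (epoch (fun i k => S i k ω) i k, S i k ω)) =
      ((μ.restrict (C ∩ pieceEvent Y S i k x)).map
        (fun ω => epoch (fun i k => S i k ω) i k)).prod η := by
  have hRU := (h.measurable_epoch i k).prodMk (h.measurable_holding i k)
  ext V hV
  have hD : MeasurableSet (C ∩ pieceEvent Y S i k x) :=
    (h.pastHoldings_le i k _ hC).inter (h.measurableSet_pieceEvent i k x)
  rw [Measure.map_apply hRU hV, Measure.restrict_apply (hRU hV),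
    measure_eq_tsum_inter_fiber (h.measurable_state i (k + 1)) μ ((hRU hV).inter hD)]
  have key : ∀ y, μ ((fun ω => (epoch (fun i k => S i k ω) i k, S i k ω)) ⁻¹' V ∩
      (C ∩ pieceEvent Y S i k x) ∩ {ω | Y i (k + 1) ω = y}) =
      ENNReal.ofReal (jumpProb L (x k) y) * ((μ.restrict (C ∩ pieceEvent Y S i k x)).map
        (fun ω => epoch (fun i k => S i k ω) i k)).prod η V := by
    intro y
    have := DFunLike.congr_fun (h.map_epoch_holding hL hC x y hη) V
    rw [Measure.map_apply hRU hV, Measure.restrict_apply (hRU hV), Measure.smul_apply,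
      ← inter_assoc] at this
    exact this
  simp_rw [key]
  rw [ENNReal.tsum_mul_right, hL.tsum_ofReal_jumpProb, one_mul]

/-- Independence factors the jump term into the mean change of `f` and the probability of jumping by
`t`. That probability is the exit rate times the mean waiting time, which is what the drift term
contributes. -/
theorem setIntegral_jump_eq_zero (h : IsStratifiedJumpProcess L ν μ Y S)
    (hL : IsQMatrix L) {f : E → ℝ} {K : ℝ} (hf : ∀ y, |f y| ≤ K) {i k : ℕ} {C : Set Ω}
    (hC : MeasurableSet[pastHoldings Y S i k] C) (x : ℕ → E) (t : ℝ≥0) :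
    ∫ ω in C ∩ pieceEvent Y S i k x,
      ({ω | epoch (fun i k => S i k ω) i (k + 1) ≤ t}.indicator
          (fun ω => f (Y i (k + 1) ω) - f (x k)) ω -
        ((min (t : ℝ≥0∞) (epoch (fun i k => S i k ω) i (k + 1))).toReal -
          (min (t : ℝ≥0∞) (epoch (fun i k => S i k ω) i k)).toReal) * genApply L f (x k)) ∂μ
      = 0 := by
  obtain ⟨η, hη⟩ := exists_isExpLaw (hL.exitRate_nonneg (x k))
  have := hη.prob
  set D := C ∩ pieceEvent Y S i k x with hDdef
  have hD : MeasurableSet D :=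
    (h.pastHoldings_le i k _ hC).inter (h.measurableSet_pieceEvent i k x)
  have hR := h.measurable_epoch i k
  have hR1 := h.measurable_epoch i (k + 1)
  have hRU := hR.prodMk (h.measurable_holding i k)
  set α := (μ.restrict D).map (fun ω => epoch (fun i k => S i k ω) i k) with hα
  have hαf : IsFiniteMeasure α := by
    rw [hα]
    infer_instance
  set V : Set (ℝ≥0∞ × ℝ≥0∞) := {p | p.1 + p.2 ≤ t} with hV
  have hVm : MeasurableSet V :=
    measurableSet_le (measurable_fst.add measurable_snd) measurable_const
  have hpre : {ω | epoch (fun i k => S i k ω) i (k + 1) ≤ t} =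
      (fun ω => (epoch (fun i k => S i k ω) i k, S i k ω)) ⁻¹' V := by
    ext ω
    simp only [mem_ofPred_eq, mem_preimage, hV, epoch_succ]
  have hGm : MeasurableSet {ω | epoch (fun i k => S i k ω) i (k + 1) ≤ t} := by
    rw [hpre]
    exact hRU hVm
  have hfm : Measurable f := measurable_of_countable f
  have hint1 : Integrable ({ω | epoch (fun i k => S i k ω) i (k + 1) ≤ t}.indicator
      (fun ω => f (Y i (k + 1) ω) - f (x k))) (μ.restrict D) := by
    refine Integrable.of_bound (C := K + K) (((hfm.comp (h.measurable_state i (k + 1))).sub_const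
      _).indicator hGm).aestronglyMeasurable (Eventually.of_forall fun ω => ?_)
    refine (norm_indicator_le_norm_self _ _).trans ((abs_sub _ _).trans ?_)
    exact add_le_add (hf _) (hf _)
  have hG : Measurable fun p : ℝ≥0∞ × ℝ≥0∞ =>
      (min (t : ℝ≥0∞) (p.1 + p.2)).toReal - (min (t : ℝ≥0∞) p.1).toReal :=
    (measurable_const.min (measurable_fst.add measurable_snd)).ennreal_toReal.sub
      (measurable_const.min measurable_fst).ennreal_toReal
  have hint2 : Integrable (fun ω =>
      (min (t : ℝ≥0∞) (epoch (fun i k => S i k ω) i (k + 1))).toReal -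
        (min (t : ℝ≥0∞) (epoch (fun i k => S i k ω) i k)).toReal) (μ.restrict D) := by
    refine Integrable.of_bound (C := (t : ℝ)) ?_
      (Eventually.of_forall fun ω => abs_min_toReal_sub_le t _ _)
    exact ((measurable_const.min hR1).ennreal_toReal.sub
      (measurable_const.min hR).ennreal_toReal).aestronglyMeasurable
  have hfirst : ∫ ω in D, {ω | epoch (fun i k => S i k ω) i (k + 1) ≤ t}.indicator
      (fun ω => f (Y i (k + 1) ω) - f (x k)) ω ∂μ =
      (∑' y, jumpProb L (x k) y * (f y - f (x k))) * (α.prod η).real V := by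
    have hunion : D = ⋃ y, D ∩ {ω | Y i (k + 1) ω = y} := by
      rw [← inter_iUnion]
      refine (inter_eq_left.2 fun ω _ => ?_).symm
      simp
    have hDy : ∀ y, MeasurableSet (D ∩ {ω | Y i (k + 1) ω = y}) := fun y =>
      hD.inter (h.measurable_state i (k + 1) (measurableSet_singleton y))
    rw [hunion, integral_iUnion hDy, ← tsum_mul_right]
    · refine tsum_congr fun y => ?_
      rw [setIntegral_indicator hGm]
      rw [setIntegral_congr_fun (g := fun _ => f y - f (x k)) ((hDy y).inter hGm)
        (fun ω hω => congrArg (fun z => f z - f (x k)) hω.1.2)]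
      rw [setIntegral_const, smul_eq_mul]
      have := DFunLike.congr_fun (h.map_epoch_holding hL hC x y hη) V
      rw [Measure.map_apply hRU hVm, Measure.restrict_apply (hRU hVm), Measure.smul_apply,
        ← hpre, inter_comm] at this
      rw [measureReal_def, this, smul_eq_mul, ENNReal.toReal_mul,
        ENNReal.toReal_ofReal (hL.jumpProb_nonneg _ _), ← measureReal_def]
      ring
    · intro y z hyz
      exact disjoint_left.2 fun ω h1 h2 => hyz (h1.2.symm.trans h2.2)
    · rw [← hunion]
      exact hint1
  have hsecond : ∫ ω in D, ((min (t : ℝ≥0∞) (epoch (fun i k => S i k ω) i (k + 1))).toReal -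
        (min (t : ℝ≥0∞) (epoch (fun i k => S i k ω) i k)).toReal) ∂μ =
      ∫ r, ∫ u, ((min (t : ℝ≥0∞) (r + u)).toReal - (min (t : ℝ≥0∞) r).toReal) ∂η ∂α := by
    have hGint : Integrable (fun p : ℝ≥0∞ × ℝ≥0∞ =>
        (min (t : ℝ≥0∞) (p.1 + p.2)).toReal - (min (t : ℝ≥0∞) p.1).toReal) (α.prod η) :=
      Integrable.of_bound (C := (t : ℝ)) hG.aestronglyMeasurable
        (Eventually.of_forall fun p => abs_min_toReal_sub_le t _ _)
    rw [← integral_prod _ hGint, hα, ← h.map_epoch_holding' hL hC x hη,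
      integral_map hRU.aemeasurable hG.aestronglyMeasurable]
    simp only [epoch_succ, hDdef]
  -- Fubini, with `IsExpLaw.measureReal_add_le` for each fixed epoch `r`.
  have hVint : (α.prod η).real V = exitRate L (x k) *
      ∫ r, ∫ u, ((min (t : ℝ≥0∞) (r + u)).toReal - (min (t : ℝ≥0∞) r).toReal) ∂η ∂α := by
    have h1 : Integrable (V.indicator fun _ => (1 : ℝ)) (α.prod η) :=
      (integrable_const _).indicator hVm
    rw [← integral_indicator_one hVm, ← integral_const_mul]
    refine (integral_prod _ h1).trans ?_
    congr 1 with r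
    rw [← hη.measureReal_add_le t r]
    have h2 : MeasurableSet {u | r + u ≤ t} :=
      measurableSet_le (measurable_const.add measurable_id) measurable_const
    rw [← integral_indicator_one h2]
    rfl
  rw [integral_sub hint1 (hint2.mul_const _), integral_mul_const, hfirst, hsecond, hVint,
    hL.genApply_eq hf]
  ring

end IsStratifiedJumpProcess

theorem coe_toNNReal_min (t : ℝ≥0) (a : ℝ≥0∞) :
    ((min (t : ℝ≥0∞) a).toNNReal : ℝ≥0∞) = min (t : ℝ≥0∞) a :=
  ENNReal.coe_toNNReal (ne_top_of_le_ne_top ENNReal.coe_ne_top (min_le_left _ _))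

theorem toNNReal_min_le (t : ℝ≥0) (a : ℝ≥0∞) : (min (t : ℝ≥0∞) a).toNNReal ≤ t := by
  rw [← ENNReal.coe_le_coe, coe_toNNReal_min]
  exact min_le_left _ _

namespace IsStratifiedJumpProcess

section Pathwise

variable {E Ω : Type*} [TopologicalSpace E] [MeasurableSpace E] [MeasurableSpace Ω]
  {L : E → E → ℝ} {ν : Measure E} {μ : Measure Ω} {Y : ℕ → ℕ → Ω → E} {S : ℕ → ℕ → Ω → ℝ≥0∞}

/-- The path is constant between consecutive epochs, so the time integral is a length times a
constant and `f` changes only if the jump occurs by `t`. -/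
theorem dynkinProcess_epoch_succ_sub (h : IsStratifiedJumpProcess L ν μ Y S) (f : E → ℝ) {K : ℝ}
    (hK : 0 ≤ K) (hg : ∀ x, |genApply L f x| ≤ K) (i k : ℕ) (t : ℝ≥0) (ω : Ω) :
    dynkinProcess L f (stratifiedProcess Y S)
        (min (t : ℝ≥0∞) (epoch (fun i k => S i k ω) i (k + 1))).toNNReal ω -
      dynkinProcess L f (stratifiedProcess Y S)
        (min (t : ℝ≥0∞) (epoch (fun i k => S i k ω) i k)).toNNReal ω =
      {ω | epoch (fun i k => S i k ω) i (k + 1) ≤ t}.indicator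
          (fun ω => f (Y i (k + 1) ω) - f (Y i k ω)) ω -
        ((min (t : ℝ≥0∞) (epoch (fun i k => S i k ω) i (k + 1))).toReal -
          (min (t : ℝ≥0∞) (epoch (fun i k => S i k ω) i k)).toReal) * genApply L f (Y i k ω) := by
  have hmono := epoch_mono (fun i k => S i k ω) i k.le_succ
  rcases lt_or_ge (t : ℝ≥0∞) (epoch (fun i k => S i k ω) i k) with ht | ht
  · have ht' := ht.trans_le hmono
    rw [min_eq_left ht.le, min_eq_left ht'.le, indicator_of_notMem (by exact not_le.2 ht')]
    simp
  set a := (min (t : ℝ≥0∞) (epoch (fun i k => S i k ω) i k)).toNNReal with ha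
  set b := (min (t : ℝ≥0∞) (epoch (fun i k => S i k ω) i (k + 1))).toNNReal with hb
  have ha' : (a : ℝ≥0∞) = epoch (fun i k => S i k ω) i k := by
    rw [ha, coe_toNNReal_min, min_eq_right ht]
  have hb' : (b : ℝ≥0∞) = min (t : ℝ≥0∞) (epoch (fun i k => S i k ω) i (k + 1)) :=
    coe_toNNReal_min _ _
  have hab : a ≤ b := by
    rw [← ENNReal.coe_le_coe, ha', hb']
    exact le_min ht hmono
  have hfin : epoch (fun i k => S i k ω) i k < ⊤ := ht.trans_lt ENNReal.coe_lt_top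
  have hZ : ∀ u : ℝ≥0, a ≤ u → (u : ℝ≥0∞) < epoch (fun i k => S i k ω) i (k + 1) →
      stratifiedProcess Y S u ω = some (Y i k ω) := fun u hu hu' =>
    stratifiedPath_of_mem (ha'.symm.le.trans (ENNReal.coe_le_coe.2 hu)) hu'
  have hZa : stratifiedProcess Y S a ω = some (Y i k ω) := by
    refine hZ a le_rfl ?_
    rw [ha']
    exact h.epoch_lt_epoch_succ hfin
  have hint : (∫ s in (0 : ℝ)..b, extendZero (genApply L f) (stratifiedProcess Y S s.toNNReal ω)) -
      ∫ s in (0 : ℝ)..a, extendZero (genApply L f) (stratifiedProcess Y S s.toNNReal ω) =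
      (b - a) * genApply L f (Y i k ω) := by
    have hii := fun a b : ℝ => intervalIntegrable_path (X := stratifiedProcess Y S)
      (fun ω s => eventually_stratifiedPath_eq _ _ s) hg hK a b ω
    have h0 := intervalIntegral.integral_interval_sub_left (hii 0 b) (hii 0 a)
    rw [h0, ← smul_eq_mul, ← intervalIntegral.integral_const,
      intervalIntegral.integral_of_le (NNReal.coe_le_coe.2 hab),
      intervalIntegral.integral_of_le (NNReal.coe_le_coe.2 hab),
      integral_Ioc_eq_integral_Ioo, integral_Ioc_eq_integral_Ioo]
    refine setIntegral_congr_fun measurableSet_Ioo fun s hs => ?_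
    have h1 : a ≤ s.toNNReal := by
      rw [← NNReal.coe_le_coe, Real.coe_toNNReal s (a.coe_nonneg.trans hs.1.le)]
      exact hs.1.le
    have h2 : s.toNNReal < b := by
      rw [← NNReal.coe_lt_coe, Real.coe_toNNReal s (a.coe_nonneg.trans hs.1.le)]
      exact hs.2
    have h3 : (s.toNNReal : ℝ≥0∞) < epoch (fun i k => S i k ω) i (k + 1) :=
      (ENNReal.coe_lt_coe.2 h2).trans_le (hb'.le.trans (min_le_right _ _))
    simp only [hZ _ h1 h3, extendZero, Option.elim_some]
  have hfb : extendZero f (stratifiedProcess Y S b ω) - f (Y i k ω) =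
      {ω | epoch (fun i k => S i k ω) i (k + 1) ≤ t}.indicator
          (fun ω => f (Y i (k + 1) ω) - f (Y i k ω)) ω := by
    rcases lt_or_ge (t : ℝ≥0∞) (epoch (fun i k => S i k ω) i (k + 1)) with ht' | ht'
    · rw [indicator_of_notMem (by exact not_le.2 ht'), hZ b hab (by rwa [hb', min_eq_left ht'.le])]
      simp [extendZero]
    · rw [indicator_of_mem (by exact ht')]
      rw [min_eq_right ht'] at hb'
      have : stratifiedProcess Y S b ω = some (Y i (k + 1) ω) := by
        refine stratifiedPath_of_mem hb'.symm.le ?_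
        rw [hb']
        exact h.epoch_lt_epoch_succ (ht'.trans_lt ENNReal.coe_lt_top)
      simp [this, extendZero]
  rw [← hfb]
  unfold dynkinProcess
  rw [hZa]
  have hra : (min (t : ℝ≥0∞) (epoch (fun i k => S i k ω) i k)).toReal = a := rfl
  have hrb : (min (t : ℝ≥0∞) (epoch (fun i k => S i k ω) i (k + 1))).toReal = b := rfl
  rw [hra, hrb, ← hint]
  simp only [extendZero, Option.elim_some]
  ring

end Pathwise

section Trace

variable {E Ω : Type*} [TopologicalSpace E] [MeasurableSpace E] [MeasurableSingletonClass E]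
  [Countable E] [MeasurableSpace Ω]
  {L : E → E → ℝ} {ν : Measure E} {μ : Measure Ω} {Y : ℕ → ℕ → Ω → E} {S : ℕ → ℕ → Ω → ℝ≥0∞}

/-- On a piece event, before the next jump, the process carries no information other than the
past of the piece and its previous holding times. -/
theorem exists_pastHoldings_inter_eq (h : IsStratifiedJumpProcess L ν μ Y S) (i k : ℕ) (x : ℕ → E)
    (s : ℝ≥0) {A : Set Ω} (hA : MeasurableSet[pathFiltration _ h.measurable_process s] A) :
    ∃ A', MeasurableSet[pastHoldings Y S i k] A' ∧
      A ∩ (pieceEvent Y S i k x ∩ {ω | (s : ℝ≥0∞) < epoch (fun i k => S i k ω) i (k + 1)}) =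
      A' ∩ (pieceEvent Y S i k x ∩ {ω | (s : ℝ≥0∞) < epoch (fun i k => S i k ω) i (k + 1)}) := by
  set B := pieceEvent Y S i k x ∩ {ω | (s : ℝ≥0∞) < epoch (fun i k => S i k ω) i (k + 1)}
  set 𝓕 := pathFiltration _ h.measurable_process
  -- The sets whose trace on `B` is the trace of a set in `pastHoldings Y S i k`. They form a
  -- σ-algebra, so it suffices to check the events that generate the filtration.
  let m : MeasurableSpace Ω :=
    ((pastHoldings Y S i k).comap (Subtype.val : B → Ω)).map (Subtype.val : B → Ω)
  suffices hle : 𝓕 s ≤ m by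
    obtain ⟨A', hA', heq⟩ := hle A hA
    refine ⟨A', hA', ?_⟩
    rw [inter_comm, inter_comm A', ← Subtype.image_preimage_val, ← Subtype.image_preimage_val, heq]
  refine iSup₂_le fun u hu => ?_
  rw [← measurable_iff_comap_le]
  suffices hone : ∀ e, ∃ A', MeasurableSet[pastHoldings Y S i k] A' ∧ ∀ ω ∈ B,
      ω ∈ A' ↔ stratifiedProcess Y S u ω = some e by
    have hsome : ∀ e : E, MeasurableSet[m] (stratifiedProcess Y S u ⁻¹' {some e}) := by
      intro e
      obtain ⟨A', hA', heq⟩ := hone e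
      refine ⟨A', hA', ?_⟩
      ext ω
      exact heq ω ω.2
    have hnone : MeasurableSet[m] (stratifiedProcess Y S u ⁻¹' {none}) := by
      have : stratifiedProcess Y S u ⁻¹' {none} =
          (⋃ e : E, stratifiedProcess Y S u ⁻¹' {some e})ᶜ := by
        ext ω
        cases hω : stratifiedProcess Y S u ω <;> simp [hω]
      rw [this]
      exact (MeasurableSet.iUnion hsome).compl
    intro D _
    rw [← biUnion_preimage_singleton]
    refine MeasurableSet.biUnion (to_countable D) fun z _ => ?_
    cases z with
    | none => exact hnone
    | some e => exact hsome e
  intro e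
  -- The time `u` falls in an earlier piece, in an earlier sojourn of piece `i`, or in the current
  -- sojourn. In the last two cases the state is the prescribed `x l` or `x k`, and in the last one
  -- no upper bound on `u` is needed, since `u` precedes the next epoch on `B`.
  refine ⟨(⋃ j, ⋃ (_ : j < i), ⋃ l, {ω | epoch (fun i k => S i k ω) j l ≤ u} ∩
      {ω | (u : ℝ≥0∞) < epoch (fun i k => S i k ω) j (l + 1)} ∩ Y j l ⁻¹' {e}) ∪
    ((⋃ l, ⋃ (_ : l < k), {ω | epoch (fun i k => S i k ω) i l ≤ u} ∩
      {ω | (u : ℝ≥0∞) < epoch (fun i k => S i k ω) i (l + 1)} ∩ {_ω | x l = e}) ∪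
    ({ω | epoch (fun i k => S i k ω) i k ≤ u} ∩ {_ω | x k = e})), ?_, ?_⟩
  · refine MeasurableSet.union ?_ (MeasurableSet.union ?_ ?_)
    · refine (le_sup_left : past Y S i ≤ pastHoldings Y S i k) _ ?_
      refine MeasurableSet.iUnion fun j => MeasurableSet.iUnion fun hj =>
        MeasurableSet.iUnion fun l => ?_
      exact ((measurable_epoch_past Y S hj l measurableSet_Iic).inter
        (measurable_epoch_past Y S hj (l + 1) measurableSet_Ioi)).inter
        (measurable_state_past Y S hj l (measurableSet_singleton e))
    · refine MeasurableSet.iUnion fun l => MeasurableSet.iUnion fun hl => ?_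
      exact ((measurable_epoch_pastHoldings Y S hl.le measurableSet_Iic).inter
        (measurable_epoch_pastHoldings Y S hl measurableSet_Ioi)).inter (MeasurableSet.const _)
    · exact (measurable_epoch_pastHoldings Y S le_rfl measurableSet_Iic).inter
        (MeasurableSet.const _)
  · rintro ω ⟨hF, hs⟩
    have hus : (u : ℝ≥0∞) < epoch (fun i k => S i k ω) i (k + 1) :=
      (ENNReal.coe_le_coe.2 hu).trans_lt hs
    have hst := stratifiedPath_eq_some_iff (fun i k => Y i k ω) (fun i k => S i k ω) u e
    unfold stratifiedProcess
    rw [hst]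
    simp only [mem_union, mem_iUnion, mem_inter_iff, mem_ofPred_eq, mem_preimage,
      mem_singleton_iff, exists_prop]
    constructor
    · rintro (⟨j, -, l, h1, h2⟩ | ⟨l, hl, h1, h2⟩ | ⟨h1, h2⟩)
      · exact ⟨j, l, h1, h2⟩
      · exact ⟨i, l, h1, ((hF.2 l hl.le).1).trans h2⟩
      · exact ⟨i, k, ⟨h1, hus⟩, ((hF.2 k le_rfl).1).trans h2⟩
    · rintro ⟨j, l, ⟨h1, h1'⟩, h2⟩
      rcases lt_trichotomy j i with hj | rfl | hj
      · exact Or.inl ⟨j, hj, l, ⟨h1, h1'⟩, h2⟩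
      · rcases lt_trichotomy l k with hl | rfl | hl
        · exact Or.inr (Or.inl ⟨l, hl, ⟨h1, h1'⟩, ((hF.2 l hl.le).1).symm.trans h2⟩)
        · exact Or.inr (Or.inr ⟨h1, ((hF.2 l le_rfl).1).symm.trans h2⟩)
        · exact absurd hus (not_lt.2 ((epoch_mono _ j hl).trans h1))
      · refine absurd hus (not_lt.2 ((epoch_le_explosionTime _ i (k + 1)).trans ?_))
        exact (explosionTime_mono _ hj).trans ((explosionTime_le_epoch _ j l).trans h1)

end Trace

end IsStratifiedJumpProcess

/-! ### Constant integrals of the stopped process -/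

theorem martingale_of_setIntegral_eq {Ω ι : Type*} [Preorder ι] {m : MeasurableSpace Ω}
    {μ : Measure Ω} [IsFiniteMeasure μ] {𝓕 : Filtration ι m} {M : ι → Ω → ℝ}
    (hadapted : ∀ t, StronglyMeasurable[𝓕 t] (M t)) (hint : ∀ t, Integrable (M t) μ)
    (hM : ∀ s t, s ≤ t → ∀ A, MeasurableSet[𝓕 s] A → ∫ ω in A, M t ω ∂μ = ∫ ω in A, M s ω ∂μ) :
    Martingale M 𝓕 μ := by
  refine ⟨hadapted, fun s t hst => ?_⟩
  refine (ae_eq_condExp_of_forall_setIntegral_eq (𝓕.le s) (hint t)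
    (fun A _ _ => (hint s).integrableOn) (fun A hA _ => (hM s t hst A hA).symm)
    (hadapted s).aestronglyMeasurable).symm

/-- The process `dynkinProcess L f Z` stopped at the time `τ`. -/
noncomputable def stoppedDynkin {E Ω : Type*} (L : E → E → ℝ) (f : E → ℝ) (Z : ℝ≥0 → Ω → Option E)
    (τ : Ω → ℝ≥0∞) (t : ℝ≥0) (ω : Ω) : ℝ :=
  dynkinProcess L f Z (min (t : ℝ≥0∞) (τ ω)).toNNReal ω

namespace IsStratifiedJumpProcess

variable {E Ω : Type*} [TopologicalSpace E] [MeasurableSpace E] [MeasurableSingletonClass E]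
  [Countable E] [MeasurableSpace Ω] {L : E → E → ℝ} {ν : Measure E} {μ : Measure Ω}
  [IsProbabilityMeasure μ] {Y : ℕ → ℕ → Ω → E} {S : ℕ → ℕ → Ω → ℝ≥0∞} {f : E → ℝ} {K K' : ℝ}

theorem integrable_stoppedDynkin (h : IsStratifiedJumpProcess L ν μ Y S) (hK : 0 ≤ K)
    (hK' : 0 ≤ K') (hf : ∀ x, |f x| ≤ K) (hg : ∀ x, |genApply L f x| ≤ K') {τ : Ω → ℝ≥0∞}
    (hτ : Measurable τ) (t : ℝ≥0) :
    Integrable (stoppedDynkin L f (stratifiedProcess Y S) τ t) μ := by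
  refine Integrable.of_bound (C := K + K + K' * t) ?_ (Eventually.of_forall fun ω =>
    abs_dynkinProcess_le hK hK' hf hg _ (toNNReal_min_le _ _) ω)
  exact (measurable_dynkinProcess_comp (fun s _ => h.measurable_process s)
    (fun ω s => eventually_stratifiedPath_eq _ _ s) L f
    (measurable_const.min hτ).ennreal_toNNReal (fun ω => toNNReal_min_le _ _)).aestronglyMeasurable

/-- The sample space is split by the states visited so far. On each part `A` may be exchanged for an
event independent of the current holding time given the piece event, as the integrand vanishes once
the next epoch is before `s`. -/
theorem setIntegral_epoch_succ_sub_eq_zero (h : IsStratifiedJumpProcess L ν μ Y S)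
    (hL : IsQMatrix L) (hK : 0 ≤ K) (hK' : 0 ≤ K') (hf : ∀ x, |f x| ≤ K)
    (hg : ∀ x, |genApply L f x| ≤ K') (i k : ℕ) {s t : ℝ≥0} (hst : s ≤ t) {A : Set Ω}
    (hA : MeasurableSet[pathFiltration _ h.measurable_process s] A) :
    ∫ ω in A, (stoppedDynkin L f (stratifiedProcess Y S)
          (fun ω => epoch (fun i k => S i k ω) i (k + 1)) t ω -
        stoppedDynkin L f (stratifiedProcess Y S) (fun ω => epoch (fun i k => S i k ω) i k) t ω -
        (stoppedDynkin L f (stratifiedProcess Y S)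
          (fun ω => epoch (fun i k => S i k ω) i (k + 1)) s ω -
        stoppedDynkin L f (stratifiedProcess Y S) (fun ω => epoch (fun i k => S i k ω) i k) s ω))
        ∂μ = 0 := by
  set N : ℝ≥0 → Ω → ℝ := fun t ω => stoppedDynkin L f (stratifiedProcess Y S)
      (fun ω => epoch (fun i k => S i k ω) i (k + 1)) t ω -
    stoppedDynkin L f (stratifiedProcess Y S) (fun ω => epoch (fun i k => S i k ω) i k) t ω with hN
  change ∫ ω in A, (N t ω - N s ω) ∂μ = 0
  have hNint : ∀ t, Integrable (N t) μ := fun t =>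
    (h.integrable_stoppedDynkin hK hK' hf hg (h.measurable_epoch i (k + 1)) t).sub
      (h.integrable_stoppedDynkin hK hK' hf hg (h.measurable_epoch i k) t)
  have hle := (pathFiltration _ h.measurable_process).le s
  have hfin : ∀ t ω, epoch (fun i k => S i k ω) i k = ⊤ → N t ω = 0 := by
    intro t ω htop
    have : epoch (fun i k => S i k ω) i (k + 1) = ⊤ :=
      top_le_iff.1 (htop.symm.le.trans (epoch_mono _ i k.le_succ))
    simp only [hN, stoppedDynkin, htop, this, sub_self]
  have hlater : ∀ ω, epoch (fun i k => S i k ω) i (k + 1) ≤ s → N t ω - N s ω = 0 := by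
    intro ω hω
    have h1 : epoch (fun i k => S i k ω) i k ≤ s := (epoch_mono _ i k.le_succ).trans hω
    have hst' := ENNReal.coe_le_coe.2 hst
    simp only [hN, stoppedDynkin, min_eq_right h1, min_eq_right hω, min_eq_right (h1.trans hst'),
      min_eq_right (hω.trans hst'), sub_self]
  -- Only the first `k + 1` states matter; indexing by finite tuples keeps the decomposition
  -- countable. The values of `X x` beyond `k` are irrelevant.
  let X : (Fin (k + 1) → E) → ℕ → E := fun x j => x (Fin.ofNat (k + 1) j)
  have hpiece : ∀ x : ℕ → E, ∫ ω in A ∩ pieceEvent Y S i k x, (N t ω - N s ω) ∂μ = 0 := by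
    intro x
    obtain ⟨A', hA', heq⟩ := h.exists_pastHoldings_inter_eq i k x s hA
    have hF := h.measurableSet_pieceEvent i k x
    have hA'F := (h.pastHoldings_le i k _ hA').inter hF
    have hcut : ∀ B : Set Ω, MeasurableSet (B ∩ pieceEvent Y S i k x) →
        ∫ ω in B ∩ pieceEvent Y S i k x, (N t ω - N s ω) ∂μ =
        ∫ ω in B ∩ (pieceEvent Y S i k x ∩
          {ω | (s : ℝ≥0∞) < epoch (fun i k => S i k ω) i (k + 1)}), (N t ω - N s ω) ∂μ := by
      intro B hB
      rw [← inter_assoc]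
      refine setIntegral_eq_of_subset_of_forall_sdiff_eq_zero hB inter_subset_left fun ω hω => ?_
      exact hlater ω (not_lt.1 fun hlt => hω.2 ⟨hω.1, hlt⟩)
    rw [hcut A ((hle _ hA).inter hF), heq, ← hcut A' hA'F,
      integral_sub (hNint t).integrableOn (hNint s).integrableOn]
    have hzero : ∀ t, ∫ ω in A' ∩ pieceEvent Y S i k x, N t ω ∂μ = 0 := by
      intro t
      rw [← h.setIntegral_jump_eq_zero hL hf hA' x t]
      refine setIntegral_congr_fun hA'F fun ω hω => ?_
      have hx : Y i k ω = x k := (hω.2.2 k le_rfl).1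
      have := h.dynkinProcess_epoch_succ_sub f hK' hg i k t ω
      rw [hx] at this
      refine this.trans ?_
      congr 1
      simp only [indicator, hx]
    rw [hzero, hzero, sub_zero]
  -- Outside all piece events the `k`-th epoch is infinite, and there both increments are zero.
  have hsupp : ∫ ω in A, (N t ω - N s ω) ∂μ =
      ∫ ω in ⋃ x, A ∩ pieceEvent Y S i k (X x), (N t ω - N s ω) ∂μ := by
    refine setIntegral_eq_of_subset_of_forall_sdiff_eq_zero (hle _ hA)
      (iUnion_subset fun x => inter_subset_left) fun ω hω => ?_
    by_cases htop : epoch (fun i k => S i k ω) i k = ⊤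
    · rw [hfin t ω htop, hfin s ω htop, sub_zero]
    · refine absurd ?_ hω.2
      refine mem_iUnion.2 ⟨fun j => Y i j ω, hω.1, ?_, fun j hj => ⟨?_, ?_⟩⟩
      · exact (explosionTime_le_epoch _ i k).trans_lt (lt_top_iff_ne_top.2 htop)
      · simp only [X, Fin.val_ofNat, Nat.mod_eq_of_lt (Nat.lt_succ_of_le hj)]
      · exact h.holding_pos i j ω ((epoch_mono _ i hj).trans_lt (lt_top_iff_ne_top.2 htop))
  rw [hsupp, integral_iUnion]
  · simp only [hpiece, tsum_zero]
  · exact fun x => (hle _ hA).inter (h.measurableSet_pieceEvent i k (X x))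
  · intro x x' hxx'
    refine disjoint_left.2 fun ω h1 h2 => hxx' (funext fun j => ?_)
    have e1 := (h1.2.2 j (Nat.le_of_lt_succ j.2)).1
    have e2 := (h2.2.2 j (Nat.le_of_lt_succ j.2)).1
    simpa [X] using e1.symm.trans e2
  · exact ((hNint t).sub (hNint s)).integrableOn

/-- The property of a stopped process to have constant integrals over the events of the past. -/
def HasConstIntegrals (h : IsStratifiedJumpProcess L ν μ Y S) (f : E → ℝ) (τ : Ω → ℝ≥0∞) : Prop :=
  ∀ s t : ℝ≥0, s ≤ t → ∀ A, MeasurableSet[pathFiltration _ h.measurable_process s] A →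
    ∫ ω in A, stoppedDynkin L f (stratifiedProcess Y S) τ t ω ∂μ =
      ∫ ω in A, stoppedDynkin L f (stratifiedProcess Y S) τ s ω ∂μ

theorem hasConstIntegrals_epoch_succ (h : IsStratifiedJumpProcess L ν μ Y S)
    (hL : IsQMatrix L) (hK : 0 ≤ K) (hK' : 0 ≤ K') (hf : ∀ x, |f x| ≤ K)
    (hg : ∀ x, |genApply L f x| ≤ K') {i k : ℕ}
    (hk : h.HasConstIntegrals f fun ω => epoch (fun i k => S i k ω) i k) :
    h.HasConstIntegrals f fun ω => epoch (fun i k => S i k ω) i (k + 1) := by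
  intro s t hst A hA
  have h1 := fun t => (h.integrable_stoppedDynkin hK hK' hf hg
    (h.measurable_epoch i (k + 1)) t).integrableOn (s := A)
  have h2 := fun t => (h.integrable_stoppedDynkin hK hK' hf hg
    (h.measurable_epoch i k) t).integrableOn (s := A)
  have h0 := h.setIntegral_epoch_succ_sub_eq_zero hL hK hK' hf hg i k hst hA
  replace h0 := (integral_sub ((h1 t).sub (h2 t)) ((h1 s).sub (h2 s))).symm.trans h0
  rw [integral_sub' (h1 t) (h2 t), integral_sub' (h1 s) (h2 s), hk s t hst A hA] at h0
  linarith

/-- Dominated convergence: up to time `t` the process is bounded by `K + K + K' * t`, whatever the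
stopping time. -/
theorem HasConstIntegrals.of_tendsto {h : IsStratifiedJumpProcess L ν μ Y S} (hK : 0 ≤ K)
    (hK' : 0 ≤ K') (hf : ∀ x, |f x| ≤ K) (hg : ∀ x, |genApply L f x| ≤ K') {τ : ℕ → Ω → ℝ≥0∞}
    {σ : Ω → ℝ≥0∞} (hτ : ∀ n, Measurable (τ n)) (hc : ∀ n, h.HasConstIntegrals f (τ n))
    (hlim : ∀ᵐ ω ∂μ, ∀ t, Tendsto (fun n => stoppedDynkin L f (stratifiedProcess Y S) (τ n) t ω)
      atTop (𝓝 (stoppedDynkin L f (stratifiedProcess Y S) σ t ω))) :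
    h.HasConstIntegrals f σ := by
  intro s t hst A hA
  have key : ∀ t, Tendsto
      (fun n => ∫ ω in A, stoppedDynkin L f (stratifiedProcess Y S) (τ n) t ω ∂μ) atTop
      (𝓝 (∫ ω in A, stoppedDynkin L f (stratifiedProcess Y S) σ t ω ∂μ)) := by
    intro t
    refine tendsto_integral_of_dominated_convergence (fun _ => K + K + K' * t)
      (fun n => (h.integrable_stoppedDynkin hK hK' hf hg (hτ n) t).integrableOn.1)
      (integrable_const _) (fun n => Eventually.of_forall fun ω =>
        abs_dynkinProcess_le hK hK' hf hg _ (toNNReal_min_le _ _) ω) ?_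
    filter_upwards [ae_restrict_of_ae hlim] with ω hω using hω t
  refine tendsto_nhds_unique (key t) ((key s).congr fun n => ?_)
  exact (hc n s t hst A hA).symm

end IsStratifiedJumpProcess

/-! ### Passage to the limit at explosion times -/

/-- Stratification is formulated on the space of sequences; this transfers it to pieces living on
any sample space. -/
theorem IsMinimalProcess.map {E Ω : Type*} [MeasurableSpace E] [MeasurableSingletonClass E]
    [MeasurableSpace Ω] {L : E → E → ℝ} {ν : Measure E} {μ : Measure Ω} {Y : ℕ → Ω → E}
    {S : ℕ → Ω → ℝ≥0∞} (h : IsMinimalProcess L ν μ Y S) :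
    IsMinimalProcess L ν (μ.map fun ω k => (Y k ω, S k ω)) (fun k w => (w k).1)
      (fun k w => (w k).2) where
  measurable_state k := (measurable_pi_apply k).fst
  measurable_holding k := (measurable_pi_apply k).snd
  law n x s := by
    have hm : MeasurableSet {w : ℕ → E × ℝ≥0∞ |
        (∀ k ≤ n, (w k).1 = x k) ∧ ∀ k < n, (s k : ℝ≥0∞) < (w k).2} := by
      have : {w : ℕ → E × ℝ≥0∞ | (∀ k ≤ n, (w k).1 = x k) ∧ ∀ k < n, (s k : ℝ≥0∞) < (w k).2} =
          (⋂ k, ⋂ (_ : k ≤ n), (fun w : ℕ → E × ℝ≥0∞ => (w k).1) ⁻¹' {x k}) ∩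
            ⋂ k, ⋂ (_ : k < n), (fun w : ℕ → E × ℝ≥0∞ => (w k).2) ⁻¹' Ioi (s k : ℝ≥0∞) := by
        ext w
        simp
      rw [this]
      exact (MeasurableSet.iInter fun k => MeasurableSet.iInter fun _ =>
        (measurable_pi_apply k).fst (measurableSet_singleton _)).inter
        (MeasurableSet.iInter fun k => MeasurableSet.iInter fun _ =>
          (measurable_pi_apply k).snd measurableSet_Ioi)
    rw [Measure.map_apply (measurable_pi_lambda _ fun k =>
      (h.measurable_state k).prodMk (h.measurable_holding k)) hm]
    exact h.law n x s

namespace IsStratifiedJumpProcess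

section Limits

variable {E Ω : Type*} [TopologicalSpace E] [MeasurableSpace E] [MeasurableSpace Ω] {L : E → E → ℝ}
  {ν : Measure E} {μ : Measure Ω} {Y : ℕ → ℕ → Ω → E} {S : ℕ → ℕ → Ω → ℝ≥0∞}

/-- The left limit is evaluated along the jump times, which stay strictly below the explosion time
because holding times are positive. -/
theorem tendsto_state_of_hasLeftLimit (h : IsStratifiedJumpProcess L ν μ Y S) {i : ℕ} {ω : Ω}
    (hT : explosionTime (fun i k => S i k ω) (i + 1) < ⊤) {y : E}
    (hy : HasLeftLimit (minimalPath (fun k => Y i k ω) (fun k => S i k ω))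
        (explosion fun k => S i k ω).toNNReal y) :
    Tendsto (fun k => Y i k ω) atTop (𝓝 y) := by
  have hTi : explosionTime (fun i k => S i k ω) i < ⊤ :=
    (explosionTime_mono _ i.le_succ).trans_lt hT
  have hτ : (explosion fun k => S i k ω) < ⊤ := by
    refine lt_of_le_of_lt ?_ hT
    rw [explosionTime_succ]
    exact le_add_self
  set J : ℕ → ℝ≥0∞ := jumpTime fun k => S i k ω with hJ
  have hJle : ∀ k, J k ≤ explosion fun k => S i k ω := fun k => le_iSup J k
  have hJtop : ∀ k, J k ≠ ⊤ := fun k => ((hJle k).trans_lt hτ).ne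
  have hJlt : ∀ k, J k < J (k + 1) := by
    intro k
    have hpos := h.holding_pos i k ω (ENNReal.add_lt_top.2 ⟨hTi, lt_top_iff_ne_top.2 (hJtop k)⟩)
    have : J (k + 1) = J k + S i k ω := Finset.sum_range_succ _ _
    rw [this]
    exact ENNReal.lt_add_right (hJtop k) hpos.ne'
  have hpath : ∀ k, minimalPath (fun k => Y i k ω) (fun k => S i k ω) (J k).toNNReal =
      some (Y i k ω) := by
    intro k
    refine (minimalPath_eq_some _ _ _ _).2 ⟨k, ⟨?_, ?_⟩, rfl⟩
    · rw [ENNReal.coe_toNNReal (hJtop k)]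
    · rw [ENNReal.coe_toNNReal (hJtop k)]
      exact hJlt k
  have hJlim : Tendsto (fun k => (J k).toNNReal) atTop
      (𝓝[<] (explosion fun k => S i k ω).toNNReal) := by
    refine tendsto_nhdsWithin_iff.2 ⟨?_, Eventually.of_forall fun k => ?_⟩
    · exact (ENNReal.tendsto_toNNReal hτ.ne).comp (tendsto_atTop_iSup (jumpTime_mono _))
    · exact (ENNReal.toNNReal_lt_toNNReal (hJtop k) hτ.ne).2 ((hJlt k).trans_le (hJle _))
  have hcomp := hy.comp hJlim
  intro U hU
  have := hcomp (image_mem_map hU)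
  rw [mem_map] at this ⊢
  filter_upwards [this] with k hk
  rw [mem_preimage, Function.comp_apply, hpath] at hk
  obtain ⟨z, hz, hzk⟩ := hk
  rw [mem_preimage, ← Option.some.inj hzk]
  exact hz

/-- Before the explosion time the sequence is eventually constant. Otherwise the states converge to
the starting point of the next piece, so continuity of `f` handles the first term and continuity of
the primitive handles the integral. -/
theorem tendsto_stoppedDynkin_epoch (h : IsStratifiedJumpProcess L ν μ Y S) {f : E → ℝ}
    (hfc : Continuous f) {K : ℝ} (hK : 0 ≤ K) (hg : ∀ x, |genApply L f x| ≤ K) {i : ℕ} {ω : Ω}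
    (hω : explosionTime (fun i k => S i k ω) (i + 1) < ⊤ →
      HasLeftLimit (minimalPath (fun k => Y i k ω) (fun k => S i k ω))
        (explosion fun k => S i k ω).toNNReal (Y (i + 1) 0 ω)) (t : ℝ≥0) :
    Tendsto (fun k => stoppedDynkin L f (stratifiedProcess Y S)
        (fun ω => epoch (fun i k => S i k ω) i k) t ω) atTop
      (𝓝 (stoppedDynkin L f (stratifiedProcess Y S)
        (fun ω => explosionTime (fun i k => S i k ω) (i + 1)) t ω)) := by
  have hlim := tendsto_epoch (fun i k => S i k ω) i
  rcases lt_or_ge (t : ℝ≥0∞) (explosionTime (fun i k => S i k ω) (i + 1)) with ht | ht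
  · refine tendsto_const_nhds.congr' ?_
    filter_upwards [hlim.eventually_const_lt ht] with k hk
    simp only [stoppedDynkin, min_eq_left ht.le, min_eq_left hk.le]
  have hT : explosionTime (fun i k => S i k ω) (i + 1) < ⊤ := ht.trans_lt ENNReal.coe_lt_top
  have hY := h.tendsto_state_of_hasLeftLimit hT (hω hT)
  have hle : ∀ k, epoch (fun i k => S i k ω) i k ≤ t := fun k =>
    (epoch_le_explosionTime _ i k).trans ht
  have htop : ∀ k, epoch (fun i k => S i k ω) i k < ⊤ := fun k =>
    (hle k).trans_lt ENNReal.coe_lt_top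
  have hZk : ∀ k, stratifiedProcess Y S (epoch (fun i k => S i k ω) i k).toNNReal ω =
      some (Y i k ω) := by
    intro k
    refine stratifiedPath_of_mem ?_ ?_
    · rw [ENNReal.coe_toNNReal (htop k).ne]
    · rw [ENNReal.coe_toNNReal (htop k).ne]
      exact h.epoch_lt_epoch_succ (htop k)
  have hZT : stratifiedProcess Y S (explosionTime (fun i k => S i k ω) (i + 1)).toNNReal ω =
      some (Y (i + 1) 0 ω) := by
    rw [← epoch_zero] at hT ⊢
    refine stratifiedPath_of_mem ?_ ?_
    · rw [ENNReal.coe_toNNReal hT.ne]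
    · rw [ENNReal.coe_toNNReal hT.ne]
      exact h.epoch_lt_epoch_succ hT
  simp only [stoppedDynkin, dynkinProcess, min_eq_right ht, min_eq_right (hle _), hZk, hZT]
  refine (Tendsto.sub_const ?_ _).sub ?_
  · exact (hfc.tendsto _).comp hY
  · have hii := fun a b : ℝ => intervalIntegrable_path (X := stratifiedProcess Y S)
      (fun ω s => eventually_stratifiedPath_eq _ _ s) hg hK a b ω
    exact ((intervalIntegral.continuous_primitive hii 0).tendsto _).comp
      ((ENNReal.tendsto_toReal hT.ne).comp hlim)

variable [MeasurableSingletonClass E] [Countable E]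

theorem stronglyMeasurable_stoppedDynkin (h : IsStratifiedJumpProcess L ν μ Y S) (f : E → ℝ)
    {τ : Ω → ℝ≥0∞} (t : ℝ≥0) (hτ : Measurable[pathFiltration _ h.measurable_process t]
      fun ω => min (t : ℝ≥0∞) (τ ω)) :
    StronglyMeasurable[pathFiltration _ h.measurable_process t]
      (stoppedDynkin L f (stratifiedProcess Y S) τ t) := by
  refine Measurable.stronglyMeasurable ?_
  refine @measurable_dynkinProcess_comp _ _ (pathFiltration _ h.measurable_process t) _ t
    (fun s hs => ?_) (fun ω s => eventually_stratifiedPath_eq _ _ s) L f _ hτ.ennreal_toNNReal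
    (fun ω => toNNReal_min_le _ _)
  exact measurable_iff_comap_le.2 (le_iSup₂_of_le s hs le_rfl)

end Limits

variable {E Ω : Type*} [TopologicalSpace E] [MeasurableSpace E] [MeasurableSingletonClass E]
  [Countable E] [MeasurableSpace Ω] {L : E → E → ℝ} {ν : Measure E} {μ : Measure Ω}
  [IsProbabilityMeasure μ] {Y : ℕ → ℕ → Ω → E} {S : ℕ → ℕ → Ω → ℝ≥0∞} {N : ℕ} {C : Fin N → Set E}

/-- Conditioning on each of the countably many starting points makes the piece a minimal process, to
which the stratification applies. Its limit lies again in a stratum, which drives the induction over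
pieces. -/
theorem ae_hasLeftLimit_of_ae_mem (h : IsStratifiedJumpProcess L ν μ Y S)
    (hC : IsStratification L C) {i : ℕ}
    (hi : ∀ᵐ ω ∂μ, explosionTime (fun i k => S i k ω) i < ⊤ → ∃ l, Y i 0 ω ∈ C l) :
    ∀ᵐ ω ∂μ, explosionTime (fun i k => S i k ω) (i + 1) < ⊤ → (∃ l, Y (i + 1) 0 ω ∈ C l) ∧
      HasLeftLimit (minimalPath (fun k => Y i k ω) (fun k => S i k ω))
        (explosion fun k => S i k ω).toNNReal (Y (i + 1) 0 ω) := by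
  have key : ∀ x : E, ∀ᵐ ω ∂μ, (∃ l, x ∈ C l) →
      explosionTime (fun i k => S i k ω) i < ⊤ ∧ Y i 0 ω = x →
      (explosion fun k => S i k ω) < ⊤ → ∃ l, ∃ y ∈ C l,
        HasLeftLimit (minimalPath (fun k => Y i k ω) (fun k => S i k ω))
          (explosion fun k => S i k ω).toNNReal y := by
    intro x
    by_cases hx : ∃ l, x ∈ C l
    swap
    · exact Eventually.of_forall fun ω h => absurd h hx
    obtain ⟨l, hl⟩ := hx
    set B := {ω | explosionTime (fun i k => S i k ω) i < ⊤ ∧ Y i 0 ω = x}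
    have hB : MeasurableSet B :=
      (h.past_le i _ (measurable_explosionTime_past Y S i measurableSet_Iio)).inter
        (h.measurable_state i 0 (measurableSet_singleton _))
    by_cases h0 : μ B = 0
    · filter_upwards [measure_eq_zero_iff_ae_notMem.1 h0] with ω hω _ hωB
      exact absurd hωB hω
    have hmin := h.restart i x univ MeasurableSet.univ (by rwa [univ_inter])
    rw [univ_inter] at hmin
    have hm : Measurable fun ω k => (Y i k ω, S i k ω) := measurable_pi_lambda _ fun k =>
      (h.measurable_state i k).prodMk (h.measurable_holding i k)
    have hlim := ae_of_ae_map hm.aemeasurable (hC.limit l x hl _ hmin.map)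
    -- The conditional measure is a nonzero multiple of the restriction, so it has the same null
    -- sets.
    rw [ProbabilityTheory.cond, Measure.ae_ennreal_smul_measure_iff (by simp),
      ae_restrict_iff' hB] at hlim
    filter_upwards [hlim] with ω hω _ hωB hτ
    obtain ⟨j, -, -, l, -, y, hy, hy'⟩ := hω hωB hτ
    exact ⟨l, y, hy, hy'⟩
  filter_upwards [hi, ae_all_iff.2 key, h.limit i] with ω h1 h2 h3 hT
  have hTi : explosionTime (fun i k => S i k ω) i < ⊤ :=
    (explosionTime_mono _ i.le_succ).trans_lt hT
  have hτ : (explosion fun k => S i k ω) < ⊤ := by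
    refine lt_of_le_of_lt ?_ hT
    rw [explosionTime_succ]
    exact le_add_self
  obtain ⟨l, y, hy, hlim⟩ := h2 _ (h1 hTi) ⟨hTi, rfl⟩ hτ
  rw [h3 hT y hlim]
  exact ⟨⟨l, hy⟩, hlim⟩

theorem ae_mem_strata (h : IsStratifiedJumpProcess L ν μ Y S) (hC : IsStratification L C)
    (hν : ∀ᵐ x ∂ν, ∃ l, x ∈ C l) (i : ℕ) :
    ∀ᵐ ω ∂μ, explosionTime (fun i k => S i k ω) i < ⊤ → ∃ l, Y i 0 ω ∈ C l := by
  induction i with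
  | zero =>
    rw [← h.initial] at hν
    filter_upwards [ae_of_ae_map (h.measurable_state 0 0).aemeasurable hν] with ω hω _ using hω
  | succ i ih =>
    filter_upwards [h.ae_hasLeftLimit_of_ae_mem hC ih] with ω hω hT using (hω hT).1

theorem ae_hasLeftLimit (h : IsStratifiedJumpProcess L ν μ Y S) (hC : IsStratification L C)
    (hν : ∀ᵐ x ∂ν, ∃ l, x ∈ C l) (i : ℕ) :
    ∀ᵐ ω ∂μ, explosionTime (fun i k => S i k ω) (i + 1) < ⊤ →
      HasLeftLimit (minimalPath (fun k => Y i k ω) (fun k => S i k ω))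
        (explosion fun k => S i k ω).toNNReal (Y (i + 1) 0 ω) := by
  filter_upwards [h.ae_hasLeftLimit_of_ae_mem hC (h.ae_mem_strata hC hν i)] with ω hω hT
    using (hω hT).2

theorem hasConstIntegrals_explosionTime (h : IsStratifiedJumpProcess L ν μ Y S)
    (hL : IsQMatrix L) (hC : IsStratification L C) (hν : ∀ᵐ x ∂ν, ∃ l, x ∈ C l) {f : E → ℝ}
    (hfc : Continuous f) {K K' : ℝ} (hK : 0 ≤ K) (hK' : 0 ≤ K') (hf : ∀ x, |f x| ≤ K)
    (hg : ∀ x, |genApply L f x| ≤ K') (n : ℕ) :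
    h.HasConstIntegrals f fun ω => explosionTime (fun i k => S i k ω) n := by
  induction n with
  | zero =>
    intro s t _ A _
    simp only [stoppedDynkin, explosionTime_zero, min_zero]
  | succ i ih =>
    refine HasConstIntegrals.of_tendsto hK hK' hf hg (h.measurable_epoch i) (fun k => ?_) ?_
    · induction k with
      | zero => simpa only [epoch_zero] using ih
      | succ k hk => exact h.hasConstIntegrals_epoch_succ hL hK hK' hf hg hk
    · filter_upwards [h.ae_hasLeftLimit hC hν i] with ω hω t
      exact h.tendsto_stoppedDynkin_epoch hfc hK' hg hω t

end IsStratifiedJumpProcess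

end StratifiedJump

/-! ### The martingale theorem -/

theorem mainTheorem6 {E Ω : Type*} [Countable E] [TopologicalSpace E] [T2Space E]
    [MeasurableSpace E] [BorelSpace E] [MeasurableSpace Ω]
    (μ : Measure Ω) [IsProbabilityMeasure μ] (ν : Measure E) [IsProbabilityMeasure ν]
    (L : E → E → ℝ) (hL : StratifiedJump.IsQMatrix L)
    {N : ℕ} (C : Fin N → Set E) (hC : StratifiedJump.IsStratification L C)
    (hν : ∀ᵐ x ∂ν, ∃ i, x ∈ C i)
    (Y : ℕ → ℕ → Ω → E) (S : ℕ → ℕ → Ω → ℝ≥0∞)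
    (hZ : StratifiedJump.IsStratifiedJumpProcess L ν μ Y S)
    (f : BoundedContinuousFunction E ℝ)
    (hf : ∃ K : ℝ, ∀ x, |StratifiedJump.genApply L f x| ≤ K) :
    (∀ n : ℕ, Martingale
      (fun (t : ℝ≥0) (ω : Ω) =>
        StratifiedJump.dynkinProcess L f (StratifiedJump.stratifiedProcess Y S)
          (min (t : ℝ≥0∞) (StratifiedJump.explosionTime (fun i k => S i k ω) n)).toNNReal ω)
      (StratifiedJump.pathFiltration (StratifiedJump.stratifiedProcess Y S) hZ.measurable_process)
      μ) ∧
    ((∀ᵐ ω ∂μ, StratifiedJump.doubleExplosionTime (fun i k => S i k ω) = ⊤) →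
      Martingale
        (StratifiedJump.dynkinProcess L f (StratifiedJump.stratifiedProcess Y S))
        (StratifiedJump.pathFiltration (StratifiedJump.stratifiedProcess Y S)
          hZ.measurable_process)
        μ) := by
  obtain ⟨K, hK⟩ := hf
  have hg : ∀ x, |StratifiedJump.genApply L f x| ≤ max K 0 := fun x =>
    (hK x).trans (le_max_left _ _)
  have hg0 : 0 ≤ max K 0 := le_max_right _ _
  have hfb : ∀ x, |f x| ≤ ‖f‖ := f.norm_coe_le_norm
  have hT : ∀ n, Measurable fun ω => StratifiedJump.explosionTime (fun i k => S i k ω) n :=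
    fun n => by simpa only [StratifiedJump.epoch_zero] using hZ.measurable_epoch n 0
  have hconst := hZ.hasConstIntegrals_explosionTime hL hC hν f.continuous (norm_nonneg f) hg0 hfb hg
  refine ⟨fun n => ?_, fun hT' => ?_⟩
  · exact StratifiedJump.martingale_of_setIntegral_eq
      (fun t => hZ.stronglyMeasurable_stoppedDynkin f t (hZ.measurable_min_explosionTime n t))
      (fun t => hZ.integrable_stoppedDynkin (norm_nonneg f) hg0 hfb hg (hT n) t) (hconst n)
  -- The unstopped process is the one stopped at `⊤`. When $T=\infty$, the processes stopped at the
  -- explosion times eventually agree with it at each fixed time.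
  · have hlim : hZ.HasConstIntegrals f fun _ => ⊤ := by
      refine StratifiedJump.IsStratifiedJumpProcess.HasConstIntegrals.of_tendsto (norm_nonneg f) hg0
        hfb hg hT hconst ?_
      filter_upwards [hT'] with ω hω t
      refine tendsto_const_nhds.congr' ?_
      have h1 : Tendsto (StratifiedJump.explosionTime fun i k => S i k ω) atTop (𝓝 ⊤) := by
        rw [← hω]
        exact tendsto_atTop_iSup (StratifiedJump.explosionTime_mono _)
      filter_upwards [h1.eventually_const_lt (ENNReal.coe_lt_top (r := t))] with n hn
      simp only [StratifiedJump.stoppedDynkin, min_eq_left hn.le, min_eq_left le_top]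
    have heq : StratifiedJump.stoppedDynkin L f (StratifiedJump.stratifiedProcess Y S)
        (fun _ => ⊤) = StratifiedJump.dynkinProcess L f (StratifiedJump.stratifiedProcess Y S) := by
      ext t ω
      simp [StratifiedJump.stoppedDynkin]
    rw [← heq]
    exact StratifiedJump.martingale_of_setIntegral_eq
      (fun t => hZ.stronglyMeasurable_stoppedDynkin f t measurable_const)
      (fun t => hZ.integrable_stoppedDynkin (norm_nonneg f) hg0 hfb hg measurable_const t) hlim
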